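/- All groups are finite. Let $t$ be a natural number. Call a subgroup $H$ of a group $G$ $\mathrm{K}$-$\mathbb{P}_t$-subnormal in $G$ if there is a chain of subgroups $H=H_0\le H_1\le\cdots\le H_n=G$ such that, for every $i=1,\dots,n$, either $H_{i-1}\trianglelefteq H_i$, or $|H_i:H_{i-1}|$ is a prime $p$ such that $p-1$ is not divisible by the $(t+1)$th power of any prime. Let $\mathfrak{H}$ be the class of all groups in which every Sylow subgroup is $\mathrm{K}$-$\mathbb{P}_t$-subnormal. A formation is a class of groups (closed under isomorphism) that is closed under quotients and contains $G/(N_1\cap N_2)$ whenever $N_1,N_2\trianglelefteq G$ and it contains $G/N_1$ and $G/N_2$; it is hereditary if it is closed under subgroups, and saturated if it contains every $G$ for which it contains $G/\Phi(G)$, where $\Phi(G)$ is the Frattini subgroup. A local function $f$ assigns a formation $f(p)$ to every prime $p$, and the formation it defines is the class $LF(f)$ of all groups $G$ such that $G/C_G(H/K)\in f(p)$ for every chief factor $H/K$ of $G$ and every prime $p$ dividing $|H/K|$. Let $\mathfrak{N}_p$ be the class of all $p$-groups, $\mathfrak{A}(p-1)$ the class of all abelian groups of exponent dividing $p-1$,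 and $\mathfrak{N}_p\mathfrak{A}(p-1)$ the class of all groups $G$ with a normal subgroup $N\in\mathfrak{N}_p$ such that $G/N\in\mathfrak{A}(p-1)$. Theorem 3.2. $\mathfrak{H}$ is a hereditary saturated formation. It is defined by the local function $F$, that is, $F(p)$ is a formation for every prime $p$ and $\mathfrak{H}=LF(F)$, where $F(p)$ is the class of all soluble groups whose Sylow subgroups all lie in $\mathfrak{N}_p\mathfrak{A}(p-1)$ if $p-1$ is not divisible by the $(t+1)$th power of any prime, and $F(p)=\mathfrak{N}_p$ if $p-1$ is divisible by the $(t+1)$th power of some prime. -/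

import Mathlib

universe u

namespace GroupFormation

/-- A class of finite groups, given by its membership predicate. Closure under isomorphism is
required where it matters, in `IsFormation`. -/
abbrev GroupClass : Type (u + 1) := (G : Type u) → [Group G] → [Finite G] → Prop

/-- `X` is a formation: it is closed under isomorphism, under quotients, and
`G/N₁, G/N₂ ∈ X` implies `G/(N₁ ∩ N₂) ∈ X`. -/
structure IsFormation (X : GroupClass.{u}) : Prop where
  iso_closed : ∀ (G H : Type u) [Group G] [Finite G] [Group H] [Finite H],
    Nonempty (G ≃* H) → X G → X H
  quotient_closed : ∀ (G : Type u) [Group G] [Finite G] (N : Subgroup G) [N.Normal],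
    X G → X (G ⧸ N)
  inf_closed : ∀ (G : Type u) [Group G] [Finite G] (N₁ N₂ : Subgroup G) [N₁.Normal] [N₂.Normal],
    X (G ⧸ N₁) → X (G ⧸ N₂) → X (G ⧸ (N₁ ⊓ N₂))

/-- `X` contains, together with every group, all its subgroups. -/
def IsHereditary (X : GroupClass.{u}) : Prop :=
  ∀ (G : Type u) [Group G] [Finite G] (H : Subgroup G), X G → X H

/-- `X` is saturated: `G/Φ(G) ∈ X` implies `G ∈ X`. -/
def IsSaturated (X : GroupClass.{u}) : Prop :=
  ∀ (G : Type u) [Group G] [Finite G], X (G ⧸ frattini G) → X G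

/-- `H/K` is a chief factor of `G`, for normal subgroups `K` and `H` of `G`: `K < H`, and no normal
subgroup of `G` lies strictly between `K` and `H`. -/
def IsChiefFactor {G : Type u} [Group G] (H K : Subgroup G) [H.Normal] [K.Normal] : Prop :=
  K < H ∧ ∀ L : Subgroup G, L.Normal → K ≤ L → L ≤ H → L = K ∨ L = H

/-- `C_G(H/K)`, the preimage in `G` of the centralizer of `H/K` in `G/K`. -/
def factorCentralizer {G : Type u} [Group G] (H K : Subgroup G) [K.Normal] : Subgroup G :=
  (Subgroup.centralizer (H.map (QuotientGroup.mk' K) : Set (G ⧸ K))).comap (QuotientGroup.mk' K)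

instance factorCentralizer_normal {G : Type u} [Group G] (H K : Subgroup G) [hH : H.Normal]
    [K.Normal] : (factorCentralizer H K).Normal := by
  have : (H.map (QuotientGroup.mk' K)).Normal := hH.map _ (QuotientGroup.mk'_surjective K)
  unfold factorCentralizer
  infer_instance

/-- A local function: it assigns a formation to every prime. -/
def IsLocalFunction (f : Nat.Primes → GroupClass.{u}) : Prop := ∀ p, IsFormation (f p)

/-- `LF(f)`: the class of all `G` such that `G/C_G(H/K) ∈ f(p)` for every chief factor `H/K` of `G`
and every prime `p` dividing `|H/K|`. -/
def LF (f : Nat.Primes → GroupClass.{u}) : GroupClass.{u} := fun G _ _ =>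
  ∀ (H K : Subgroup G) [H.Normal] [K.Normal], IsChiefFactor H K →
    ∀ p : Nat.Primes, (p : ℕ) ∣ K.relIndex H → f p (G ⧸ factorCentralizer H K)

/-- `X` is a local formation, defined by the local function `f`. -/
def IsLocallyDefinedBy (X : GroupClass.{u}) (f : Nat.Primes → GroupClass.{u}) : Prop :=
  IsLocalFunction f ∧ X = LF f

/-- `n` is not divisible by the `(t + 1)`-th power of any prime. -/
def PowerFree (t n : ℕ) : Prop := ∀ q : ℕ, q.Prime → ¬ q ^ (t + 1) ∣ n

/-- One step `A ≤ B` of a chain: `A` is normal in `B`, or `|B : A|` is a prime `p` such that `p - 1`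
is not divisible by the `(t + 1)`-th power of any prime. -/
def IsKPtStep (t : ℕ) {G : Type u} [Group G] (A B : Subgroup G) : Prop :=
  A ≤ B ∧ ((A.subgroupOf B).Normal ∨
    ∃ p : ℕ, p.Prime ∧ A.relIndex B = p ∧ PowerFree t (p - 1))

/-- `H` is K-`ℙ_t`-subnormal in `G`: some finite chain of such steps leads from `H` to `G`. -/
def IsKPtSubnormal (t : ℕ) {G : Type u} [Group G] (H : Subgroup G) : Prop :=
  Relation.ReflTransGen (IsKPtStep t) H ⊤

/-- The class of all groups in which every Sylow subgroup is K-`ℙ_t`-subnormal. -/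
def sylowKPt (t : ℕ) : GroupClass.{u} := fun G _ _ =>
  ∀ q : ℕ, q.Prime → ∀ P : Sylow q G, IsKPtSubnormal t (P : Subgroup G)

/-- The class of all soluble groups. -/
def soluble : GroupClass.{u} := fun G _ _ => Group.IsSolvable G

/-- `𝔑_p`, the class of all `p`-groups. -/
def pGroups (p : ℕ) : GroupClass.{u} := fun G _ _ => IsPGroup p G

/-- `𝔄(n)`, the class of all abelian groups of exponent dividing `n`. -/
def abelianOfExponent (n : ℕ) : GroupClass.{u} := fun G _ _ =>
  (∀ a b : G, a * b = b * a) ∧ Monoid.exponent G ∣ n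

/-- The product `XY` of two classes: groups `G` with a normal subgroup `N ∈ X` and `G/N ∈ Y`. -/
def classProduct (X Y : GroupClass.{u}) : GroupClass.{u} := fun G _ _ =>
  ∃ (N : Subgroup G) (_ : N.Normal), X N ∧ Y (G ⧸ N)

/-- The class of all soluble groups whose Sylow subgroups all lie in `X`. -/
def solubleWithSylowIn (X : GroupClass.{u}) : GroupClass.{u} := fun G _ _ =>
  soluble G ∧ ∀ q : ℕ, q.Prime → ∀ P : Sylow q G, X P

open Classical in
/-- The function `F`: `F(p)` is the class of all soluble groups with Sylow subgroups in
`𝔑_p 𝔄(p - 1)` if `p - 1` is not divisible by any `(t + 1)`-th power of a prime, and is `𝔑_p`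
otherwise. -/
noncomputable def localF (t : ℕ) (p : Nat.Primes) : GroupClass.{u} :=
  if PowerFree t ((p : ℕ) - 1) then
    solubleWithSylowIn (classProduct (pGroups p) (abelianOfExponent ((p : ℕ) - 1)))
  else pGroups p

end GroupFormation

/-! Everything rests on how a Sylow q-subgroup `P` acts on a chief factor.

A K-`ℙ_t`-subnormal Sylow subgroup for the largest prime divisor is normal, so induction on the
order makes every group of the class soluble (`isSolvable_of_sylowKPt`). In soluble groups chains
survive intersection with any subgroup (`KPtChain.inf`). This gives heredity, and also the formation
property: if `N₁ ∩ N₂ = 1`, then `P = PN₁ ∩ PN₂`.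

For the local description, let `N` be an elementary abelian chief r-factor, with `q ≠ r`. Given a
chain from `P` to `PN`, a normal step makes `P` act trivially on the corresponding section of `N`. A
step of prime index has index `r`, and there `P` acts through `Aut(C_r)`, which is abelian of
exponent `r - 1`. Coprime action glues the sections: `P` acts on `N` as an abelian group of exponent
dividing `r - 1`, and trivially if `r - 1` is not power-free. Conversely such an action is
diagonalizable over the field of `r` elements, so `N` is built from P-invariant sections of order
`r`, each giving a permitted step. Climbing a chief series then produces the chain from `P` to `G`.

Saturation is proved directly, by a minimal counterexample. A minimal normal `N ≤ Φ(G)` is an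
r-group, and no other prime contributes a normal subgroup of `G/N`. Hence `G/N` has a normal
self-centralizing Sylow r-subgroup, and the action of `P` on it forces `P` itself to be abelian of
exponent dividing `r - 1`, or trivial. -/

namespace GroupFormation

open Subgroup
open scoped commutatorElement

/-! ### Minimal normal subgroups and primitive soluble groups. -/

section General

variable {G : Type u} [Group G]

/-- A minimal normal subgroup. -/
structure IsMinimalNormal (N : Subgroup G) : Prop where
  normal : N.Normal
  ne_bot : N ≠ ⊥
  eq_bot_or_eq : ∀ L : Subgroup G, L.Normal → L ≤ N → L = ⊥ ∨ L = N

theorem exists_isMinimalNormal_le [Finite G] (M : Subgroup G) [hM : M.Normal] (h : M ≠ ⊥) :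
    ∃ N, IsMinimalNormal N ∧ N ≤ M := by
  obtain ⟨N, hN⟩ := (Set.toFinite {L : Subgroup G | L.Normal ∧ L ≠ ⊥ ∧ L ≤ M}).exists_minimal
    ⟨M, hM, h, le_rfl⟩
  refine ⟨N, ⟨hN.1.1, hN.1.2.1, fun L hL hLN => ?_⟩, hN.1.2.2⟩
  by_cases hb : L = ⊥
  · exact Or.inl hb
  · exact Or.inr (le_antisymm hLN (hN.2 ⟨hL, hb, hLN.trans hN.1.2.2⟩ hLN))

theorem IsMinimalNormal.comm [Group.IsSolvable G] {N : Subgroup G} (hN : IsMinimalNormal N) :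
    ∀ x ∈ N, ∀ y ∈ N, x * y = y * x := by
  have := hN.normal
  have hlt := Group.IsSolvable.commutator_lt_of_ne_bot hN.ne_bot
  rcases hN.eq_bot_or_eq ⁅N, N⁆ inferInstance hlt.le with h | h
  · intro x hx y hy
    exact (mem_centralizer_iff.1 ((commutator_eq_bot_iff_le_centralizer.1 h) hy) x hx)
  · exact absurd h hlt.ne

theorem IsMinimalNormal.pow_eq_one [Finite G] {N : Subgroup G} (hN : IsMinimalNormal N)
    (hc : ∀ x ∈ N, ∀ y ∈ N, x * y = y * x) {r : ℕ} (hr : r.Prime) (hd : r ∣ Nat.card N) :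
    ∀ x ∈ N, x ^ r = 1 := by
  have := hN.normal
  have := Fact.mk hr
  let L : Subgroup G :=
    { carrier := {x | x ∈ N ∧ x ^ r = 1}
      one_mem' := ⟨one_mem _, one_pow _⟩
      mul_mem' := fun {a b} ha hb =>
        ⟨mul_mem ha.1 hb.1, by
          have : Commute a b := hc a ha.1 b hb.1
          rw [this.mul_pow, ha.2, hb.2, one_mul]⟩
      inv_mem' := fun {a} ha => ⟨inv_mem ha.1, by rw [inv_pow, ha.2, inv_one]⟩ }
  have hL : L.Normal := ⟨fun x hx g => ⟨hN.normal.conj_mem x hx.1 g, by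
    rw [conj_pow, hx.2, mul_one, mul_inv_cancel]⟩⟩
  rcases hN.eq_bot_or_eq L hL (fun x hx => hx.1) with h | h
  · obtain ⟨x, hx⟩ := exists_prime_orderOf_dvd_card' r hd
    have hxL : (x : G) ∈ L := ⟨x.2, by rw [← hx]; exact_mod_cast pow_orderOf_eq_one x⟩
    rw [h, mem_bot] at hxL
    have : x = 1 := Subtype.ext hxL
    rw [this, orderOf_one] at hx
    exact absurd hx.symm hr.one_lt.ne'
  · intro x hx
    rw [← h] at hx
    exact hx.2

theorem IsMinimalNormal.isPGroup [Finite G] {N : Subgroup G} (hN : IsMinimalNormal N)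
    (hc : ∀ x ∈ N, ∀ y ∈ N, x * y = y * x) {r : ℕ} (hr : r.Prime) (hd : r ∣ Nat.card N) :
    IsPGroup r N := by
  rw [isPGroup_iff_pow_pow_eq_one]
  exact fun x => ⟨1, Subtype.ext (by simpa using hN.pow_eq_one hc hr hd x x.2)⟩

/-- `Aut(C_r)` is isomorphic to the units modulo `r`: abelian, with (r-1)-th powers trivial. -/
theorem conj_trivial_of_card_prime {V : Subgroup G} [V.Normal] {r : ℕ} (hr : r.Prime)
    (hV : Nat.card V = r) (x y v : G) (hv : v ∈ V) :
    ⁅x, y⁆ * v * ⁅x, y⁆⁻¹ = v ∧ x ^ (r - 1) * v * (x ^ (r - 1))⁻¹ = v := by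
  have := Fact.mk hr
  have hcyc : IsCyclic V := isCyclic_of_prime_card hV
  let e : MulAut V ≃* (ZMod r)ˣ := hV ▸ IsCyclic.mulAutMulEquiv V
  let f : G →* (ZMod r)ˣ := e.toMonoidHom.comp MulAut.conjNormal
  have key : ∀ g, f g = 1 → g * v * g⁻¹ = v := by
    intro g hg
    have h1 : (MulAut.conjNormal g : MulAut V) = 1 := e.injective (by simpa [f] using hg)
    rw [← MulAut.conjNormal_apply (H := V) g ⟨v, hv⟩, h1]
    rfl
  constructor
  · apply key
    rw [map_commutatorElement]
    exact commutatorElement_eq_one_iff_mul_comm.2 (mul_comm _ _)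
  · apply key
    rw [map_pow, ZMod.units_pow_card_sub_one_eq_one]

theorem commutator_mem_of_relIndex_prime {K H : Subgroup G} [K.Normal] [hH : H.Normal]
    {r : ℕ} (hr : r.Prime) (hKH : K.relIndex H = r) (x y u : G) (hu : u ∈ H) :
    ⁅⁅x, y⁆, u⁆ ∈ K ∧ ⁅x ^ (r - 1), u⁆ ∈ K := by
  have : (H.map (QuotientGroup.mk' K)).Normal := hH.map _ (QuotientGroup.mk'_surjective K)
  have hcard : Nat.card (H.map (QuotientGroup.mk' K)) = r := by
    rw [← relIndex_ker, QuotientGroup.ker_mk', hKH]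
  have h := conj_trivial_of_card_prime hr hcard (QuotientGroup.mk' K x) (QuotientGroup.mk' K y)
    (QuotientGroup.mk' K u) (mem_map_of_mem _ hu)
  rw [← map_commutatorElement, ← map_pow] at h
  constructor
  · rw [← QuotientGroup.eq_one_iff, ← QuotientGroup.mk'_apply, commutatorElement_def]
    simp only [map_mul, map_inv]
    rw [h.1, mul_inv_cancel]
  · rw [← QuotientGroup.eq_one_iff, ← QuotientGroup.mk'_apply, commutatorElement_def]
    simp only [map_mul, map_inv]
    rw [h.2, mul_inv_cancel]

theorem card_sup_mul_card_inf [Finite G] (P W : Subgroup G) [W.Normal] :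
    Nat.card (P ⊔ W : Subgroup G) * Nat.card (P ⊓ W : Subgroup G) = Nat.card P * Nat.card W := by
  have h1 := relIndex_mul_relIndex ⊥ W (P ⊔ W) bot_le le_sup_right
  have h2 := relIndex_mul_relIndex ⊥ (P ⊓ W) P bot_le inf_le_left
  rw [relIndex_sup_right, relIndex_bot_left, relIndex_bot_left] at h1
  rw [inf_relIndex_left, relIndex_bot_left, relIndex_bot_left] at h2
  rw [← h1, ← h2]
  ring

theorem relIndex_sup_dvd_card [Finite G] (P W : Subgroup G) [W.Normal] :
    P.relIndex (P ⊔ W) ∣ Nat.card W := by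
  have h1 := relIndex_mul_relIndex ⊥ P (P ⊔ W) bot_le le_sup_left
  rw [relIndex_bot_left, relIndex_bot_left] at h1
  have h2 := card_sup_mul_card_inf P W
  rw [← h1, mul_assoc] at h2
  have h3 := Nat.eq_of_mul_eq_mul_left Nat.card_pos h2
  exact ⟨_, h3.symm⟩

theorem sup_eq_top_of_index_prime {A : Subgroup G} {p : ℕ} (hp : p.Prime) (hA : A.index = p)
    {M : Subgroup G} (hM : ¬ M ≤ A) : A ⊔ M = ⊤ := by
  have h1 := relIndex_mul_index (le_sup_left : A ≤ A ⊔ M)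
  rw [hA] at h1
  rcases (Nat.dvd_prime hp).1 (Dvd.intro_left _ h1) with h | h
  · exact index_eq_one.1 h
  · rw [h] at h1
    have : A.relIndex (A ⊔ M) = 1 := Nat.eq_of_mul_eq_mul_right hp.pos (by rw [h1, one_mul])
    exact absurd (le_sup_right.trans (relIndex_eq_one.1 this)) hM

/-- In a finite soluble group, a core-free subgroup of prime index `p` is complemented by a normal
subgroup of order `p` with abelian quotient. -/
theorem exists_normal_card_eq_prime [Finite G] [Group.IsSolvable G] {A : Subgroup G} {p : ℕ}
    (hp : p.Prime) (hA : A.index = p) (hcore : A.normalCore = ⊥) :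
    ∃ M : Subgroup G, M.Normal ∧ Nat.card M = p ∧ commutator G ≤ M ∧ A ⊔ M = ⊤ := by
  have htop : (⊤ : Subgroup G) ≠ ⊥ := by
    intro h
    have : A = ⊤ := by rw [eq_top_iff, h]; exact bot_le
    rw [this, index_top] at hA
    exact hp.one_lt.ne hA
  obtain ⟨M, hM, -⟩ := exists_isMinimalNormal_le (⊤ : Subgroup G) htop
  have := hM.normal
  have hMA : ¬ M ≤ A := fun h => hM.ne_bot (le_bot_iff.1 (hcore ▸ normal_le_normalCore.2 h))
  have hsup := sup_eq_top_of_index_prime hp hA hMA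
  -- `A` normalizes `A ∩ D` because `D` is normal, and `M` centralizes it; since `AM = G`, `A ∩ D`
  -- is normal inside the core-free `A`. This is applied to `D = M` and to `D = C_G(M)`.
  have hnorm : ∀ D : Subgroup G, D.Normal → (∀ m ∈ M, ∀ d ∈ D, m * d = d * m) → A ⊓ D = ⊥ := by
    intro D hD hcD
    have : (A ⊓ D).Normal := by
      rw [← normalizer_eq_top_iff, eq_top_iff, ← hsup, sup_le_iff]
      constructor
      · exact le_normalizer_iff.2 fun a ha k hk =>
          ⟨A.mul_mem (A.mul_mem ha hk.1) (A.inv_mem ha), hD.conj_mem k hk.2 a⟩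
      · refine le_normalizer_iff.2 fun m hm k hk => ?_
        rwa [hcD m hm k hk.2, mul_inv_cancel_right]
    exact le_bot_iff.1 (hcore ▸ normal_le_normalCore.2 inf_le_left)
  have hinf : A ⊓ M = ⊥ := hnorm M hM.normal hM.comm
  have hcard : Nat.card M = p := by
    have h := card_sup_mul_card_inf A M
    rw [hsup, hinf, card_bot, mul_one, card_top, ← A.card_mul_index, hA] at h
    exact (Nat.eq_of_mul_eq_mul_left Nat.card_pos h).symm
  refine ⟨M, hM.normal, hcard, ?_, hsup⟩
  have hC : commutator G ≤ centralizer M := by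
    rw [_root_.commutator_def, commutator_le]
    intro x _ y _
    rw [mem_centralizer_iff]
    intro v hv
    exact (mul_inv_eq_iff_eq_mul.1 (conj_trivial_of_card_prime hp hcard x y v hv).1).symm
  have hAC : A ⊓ centralizer (M : Set G) = ⊥ :=
    hnorm _ inferInstance (fun m hm d hd => (mem_centralizer_iff.1 hd m hm))
  refine hC.trans fun c hc => ?_
  have hct : c ∈ A ⊔ M := hsup ▸ mem_top c
  obtain ⟨a, ha, m, hm, rfl⟩ := mem_sup_of_normal_right.1 hct
  have hmc : m ∈ centralizer (M : Set G) := mem_centralizer_iff.2 fun v hv => hM.comm v hv m hm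
  have haA : a ∈ A ⊓ centralizer (M : Set G) := ⟨ha, by
    simpa using mul_mem hc (inv_mem hmc)⟩
  rw [hAC, mem_bot] at haA
  rw [haA, one_mul]
  exact hm

end General

/-! ### Chains under images, preimages and intersections. -/

section Chains

variable {G H : Type u} [Group G] [Group H] {t : ℕ}

/-- A chain of K-`ℙ_t`-steps from `A` to `B`. -/
abbrev KPtChain (t : ℕ) {G : Type u} [Group G] (A B : Subgroup G) : Prop :=
  Relation.ReflTransGen (IsKPtStep t) A B

theorem isKPtStep_of_conj_mem {A B : Subgroup G} (hAB : A ≤ B)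
    (h : ∀ a ∈ A, ∀ b ∈ B, b * a * b⁻¹ ∈ A) : IsKPtStep t A B :=
  ⟨hAB, Or.inl ((normal_subgroupOf_iff hAB).2 fun a b ha hb => h a ha b hb)⟩

/-- Divisibility instead of equality allows for a collapsed step: at index 1 the two subgroups
coincide and the step is a normal one. -/
theorem isKPtStep_of_relIndex_dvd {A B : Subgroup G} (hAB : A ≤ B) {p : ℕ} (hp : p.Prime)
    (h : A.relIndex B ∣ p) (hf : PowerFree t (p - 1)) : IsKPtStep t A B := by
  rcases (Nat.dvd_prime hp).1 h with h | h
  · exact isKPtStep_of_conj_mem hAB fun a ha b hb =>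
      have hB := relIndex_eq_one.1 h
      A.mul_mem (A.mul_mem (hB hb) ha) (A.inv_mem (hB hb))
  · exact ⟨hAB, Or.inr ⟨p, hp, h, hf⟩⟩

theorem IsKPtStep.map {A B : Subgroup G} (h : IsKPtStep t A B) (f : G →* H) :
    IsKPtStep t (A.map f) (B.map f) := by
  obtain ⟨hAB, h⟩ := h
  rcases h with h | ⟨p, hp, h, hf⟩
  · refine isKPtStep_of_conj_mem (map_mono hAB) ?_
    rintro _ ⟨a, ha, rfl⟩ _ ⟨b, hb, rfl⟩
    exact ⟨b * a * b⁻¹, (normal_subgroupOf_iff hAB).1 h a b ha hb, by simp⟩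
  · refine isKPtStep_of_relIndex_dvd (map_mono hAB) hp ?_ hf
    rw [← h, ← relIndex_comap]
    exact relIndex_dvd_of_le_left _ (le_comap_map f A)

theorem IsKPtStep.comap {A B : Subgroup H} (h : IsKPtStep t A B) (f : G →* H)
    (hB : B ≤ f.range) : IsKPtStep t (A.comap f) (B.comap f) := by
  obtain ⟨hAB, h⟩ := h
  rcases h with h | ⟨p, hp, h, hf⟩
  · refine isKPtStep_of_conj_mem (comap_mono hAB) fun a ha b hb => ?_
    rw [mem_comap] at *
    simpa using (normal_subgroupOf_iff hAB).1 h (f a) (f b) ha hb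
  · refine isKPtStep_of_relIndex_dvd (comap_mono hAB) hp ?_ hf
    rw [relIndex_comap, map_comap_eq_self hB, h]

theorem KPtChain.le {A B : Subgroup G} (h : KPtChain t A B) : A ≤ B := by
  induction h with
  | refl => exact le_rfl
  | tail _ h ih => exact ih.trans h.1

theorem KPtChain.map {A B : Subgroup G} (h : KPtChain t A B) (f : G →* H) :
    KPtChain t (A.map f) (B.map f) := by
  induction h with
  | refl => exact .refl
  | tail _ h ih => exact ih.tail (h.map f)

theorem KPtChain.comap {A B : Subgroup H} (h : KPtChain t A B) (f : G →* H)
    (hB : B ≤ f.range) : KPtChain t (A.comap f) (B.comap f) := by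
  induction h with
  | refl => exact .refl
  | tail _ h ih => exact (ih (h.1.trans hB)).tail (h.comap f hB)

/-- Modulo the core of `A` there is a normal `M` of order `p`, complementing `A` and containing the
derived subgroup. If the image of `U` contains `M`, the index is squeezed between `p` and `p`.
Otherwise that image meets `M` trivially, hence is abelian, and commutators of `U` fall into the
core. -/
theorem conj_mem_or_relIndex_eq_of_index_prime [Finite G] [Group.IsSolvable G] {A : Subgroup G}
    {p : ℕ} (hp : p.Prime) (hA : A.index = p) (U : Subgroup G) :
    (∀ a ∈ A ⊓ U, ∀ b ∈ U, b * a * b⁻¹ ∈ A ⊓ U) ∨ A.relIndex U = p := by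
  let K := A.normalCore
  let π := QuotientGroup.mk' K
  have hπ : Function.Surjective π := QuotientGroup.mk'_surjective K
  have hKA : K ≤ A := normalCore_le A
  have hcm : (A.map π).comap π = A := by
    rw [QuotientGroup.comap_map_mk', sup_eq_right.2 hKA]
  have hA' : (A.map π).index = p := by rw [← index_comap_of_surjective _ hπ, hcm, hA]
  have hcore : (A.map π).normalCore = ⊥ := by
    have h1 : ((A.map π).normalCore).comap π ≤ K := by
      refine normal_le_normalCore.2 ?_
      conv_rhs => rw [← hcm]
      exact comap_mono (normalCore_le _)
    rw [eq_bot_iff]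
    intro x hx
    obtain ⟨g, rfl⟩ := hπ x
    exact (QuotientGroup.eq_one_iff g).2 (h1 hx)
  have : Group.IsSolvable (G ⧸ K) := Group.isSolvable_of_surjective hπ
  obtain ⟨M, hM, hcard, hcomm, hsup⟩ := exists_normal_card_eq_prime hp hA' hcore
  have := Fact.mk hp
  by_cases hMU : M ≤ U.map π
  · right
    have h1 : A.relIndex U = (A.map π).relIndex (U.map π) := by rw [← relIndex_comap, hcm]
    have h2 : (A.map π).relIndex M = p := by
      have h4 : A.map π ⊓ M = ⊥ := by
        have h5 := card_sup_mul_card_inf (A.map π) M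
        rw [hsup, card_top, ← (A.map π).card_mul_index, hA', hcard] at h5
        refine card_eq_one.1 (Nat.eq_of_mul_eq_mul_left
          (Nat.mul_pos Nat.card_pos hp.pos : 0 < Nat.card (A.map π) * p) ?_)
        rw [h5, mul_one]
      rw [← inf_relIndex_right, h4, relIndex_bot_left, hcard]
    have h3 := relIndex_le_of_le_right (H := A.map π) hMU index_ne_zero_of_finite
    have h4 := relIndex_le_of_le_right (H := A.map π) (le_top (a := U.map π))
      index_ne_zero_of_finite
    rw [relIndex_top_right, hA'] at h4
    exact h1.trans (le_antisymm h4 (h2 ▸ h3))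
  · left
    have h1 : M ⊓ U.map π = ⊥ := by
      have h2 : Nat.card (M ⊓ U.map π : Subgroup _) ∣ p := hcard ▸ card_dvd_of_le inf_le_left
      rcases (Nat.dvd_prime hp).1 h2 with h | h
      · exact card_eq_one.1 h
      · have := eq_of_le_of_card_ge (inf_le_left : M ⊓ U.map π ≤ M) (by rw [h, hcard])
        exact absurd (inf_eq_left.1 this) hMU
    intro a ha b hb
    have h2 : ⁅b, a⁆ ∈ A := by
      have h3 : π ⁅b, a⁆ ∈ M ⊓ U.map π := by
        refine ⟨hcomm ?_, mem_map_of_mem _ ?_⟩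
        · rw [map_commutatorElement]
          exact commutator_mem_commutator (mem_top _) (mem_top _)
        · exact U.mul_mem (U.mul_mem (U.mul_mem hb ha.2) (U.inv_mem hb)) (U.inv_mem ha.2)
      rw [h1, mem_bot] at h3
      exact hKA ((QuotientGroup.eq_one_iff _).1 h3)
    refine ⟨?_, U.mul_mem (U.mul_mem hb ha.2) (U.inv_mem hb)⟩
    have := A.mul_mem h2 ha.1
    rwa [commutatorElement_def, inv_mul_cancel_right] at this

theorem IsKPtStep.inf [Finite G] [Group.IsSolvable G] {A B : Subgroup G} (h : IsKPtStep t A B)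
    (U : Subgroup G) : IsKPtStep t (A ⊓ U) (B ⊓ U) := by
  obtain ⟨hAB, h⟩ := h
  have hle : A ⊓ U ≤ B ⊓ U := inf_le_inf_right U hAB
  rcases h with h | ⟨p, hp, h, hf⟩
  · refine isKPtStep_of_conj_mem hle fun a ha b hb => ?_
    exact ⟨(normal_subgroupOf_iff hAB).1 h a b ha.1 hb.1,
      U.mul_mem (U.mul_mem hb.2 ha.2) (U.inv_mem hb.2)⟩
  · rcases conj_mem_or_relIndex_eq_of_index_prime (A := A.subgroupOf B) hp h (U.subgroupOf B)
      with h1 | h1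
    · refine isKPtStep_of_conj_mem hle fun a ha b hb => ?_
      have := h1 ⟨a, hAB ha.1⟩ ⟨ha.1, ha.2⟩ ⟨b, hb.1⟩ hb.2
      exact ⟨this.1, this.2⟩
    · refine isKPtStep_of_relIndex_dvd hle hp ?_ hf
      rw [← inf_subgroupOf_right U B, relIndex_subgroupOf inf_le_right] at h1
      rw [← h1, ← inf_relIndex_right (A ⊓ U), ← inf_relIndex_right A, inf_comm U B,
        inf_inf_inf_comm, ← inf_assoc, inf_eq_left.2 hAB, inf_assoc A U U,
        inf_idem, ← inf_assoc A B U, inf_eq_left.2 hAB]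

theorem KPtChain.inf [Finite G] [Group.IsSolvable G] {A B : Subgroup G} (h : KPtChain t A B)
    (U : Subgroup G) : KPtChain t (A ⊓ U) (B ⊓ U) := by
  induction h with
  | refl => exact .refl
  | tail _ h ih => exact ih.tail (h.inf U)

/-- Intersections of K-`ℙ_t`-subnormal subgroups of a finite soluble group. -/
theorem IsKPtSubnormal.inf [Finite G] [Group.IsSolvable G] {A B : Subgroup G}
    (hA : IsKPtSubnormal t A) (hB : IsKPtSubnormal t B) : IsKPtSubnormal t (A ⊓ B) := by
  have h := KPtChain.inf hA B
  rw [top_inf_eq] at h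
  exact h.trans hB

/-- No step above `P` can acquire new p-elements: some power `x ^ n` with `n` prime to `p` lies in
the lower term, and for a p-element `x` this brings back `x` itself. -/
theorem KPtChain.mem_of_pow_eq_one [Finite G] {p : ℕ} (hp : p.Prime)
    (hmax : ∀ r : ℕ, r.Prime → r ∣ Nat.card G → r ≤ p) (P : Sylow p G) {B : Subgroup G}
    (h : KPtChain t (P : Subgroup G) B) : ∀ x ∈ B, (∃ k, x ^ p ^ k = 1) → x ∈ P := by
  have := Fact.mk hp
  induction h with
  | refl => exact fun x hx _ => hx
  | @tail B C hPB hBC ih =>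
    have hndvd : ¬ p ∣ B.relIndex C := by
      intro hd
      refine P.not_dvd_index (hd.trans ?_)
      exact (Dvd.intro _ (relIndex_mul_index hBC.1)).trans (index_dvd_of_le (KPtChain.le hPB))
    rintro x hx ⟨k, hk⟩
    refine ih x ?_ ⟨k, hk⟩
    have key : ∃ n, n.Coprime p ∧ x ^ n ∈ B := by
      rcases hBC.2 with hn | ⟨r, hr, hrel, -⟩
      · refine ⟨B.relIndex C, ((hp.coprime_iff_not_dvd).2 hndvd).symm, ?_⟩
        exact pow_index_mem (B.subgroupOf C) (⟨x, hx⟩ : C)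
      · have hrp : r < p := by
          refine lt_of_le_of_ne (hmax r hr ?_) ?_
          · rw [← hrel]
            exact (relIndex_dvd_card _ _).trans (card_subgroup_dvd_card C)
          · rintro rfl
            exact hndvd (hrel ▸ dvd_rfl)
        obtain ⟨n, hn0, hnr, hn⟩ := exists_pow_mem_of_relIndex_ne_zero
          (by rw [hrel]; exact hr.ne_zero : B.relIndex C ≠ 0) hx
        exact ⟨n, (hp.coprime_iff_not_dvd.2 (Nat.not_dvd_of_pos_of_lt hn0 (by omega))).symm,
          hn.1⟩
    obtain ⟨n, hn, hxn⟩ := key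
    have hcop : n.Coprime (p ^ k) := Nat.Coprime.pow_right k hn
    have h1 : IsCoprime (n : ℤ) ((p ^ k : ℕ) : ℤ) := Nat.isCoprime_iff_coprime.2 hcop
    obtain ⟨a, b, hab⟩ := h1
    have h2 : x = (x ^ n) ^ a * (x ^ p ^ k) ^ b := by
      rw [← zpow_natCast, ← zpow_natCast, ← zpow_mul, ← zpow_mul, ← zpow_add, mul_comm _ a,
        mul_comm _ b, hab, zpow_one]
    rw [h2, hk, one_zpow, mul_one]
    exact B.zpow_mem hxn a

/-- A K-`ℙ_t`-subnormal Sylow subgroup for the largest prime divisor is normal. -/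
theorem sylow_normal_of_isKPtSubnormal [Finite G] {p : ℕ} (hp : p.Prime)
    (hmax : ∀ r : ℕ, r.Prime → r ∣ Nat.card G → r ≤ p) (P : Sylow p G)
    (h : IsKPtSubnormal t (P : Subgroup G)) : (P : Subgroup G).Normal := by
  refine ⟨fun x hx g => KPtChain.mem_of_pow_eq_one hp hmax P h _ (mem_top _) ?_⟩
  obtain ⟨k, hk⟩ := (isPGroup_iff_pow_pow_eq_one.1 P.isPGroup') ⟨x, hx⟩
  have hk' : x ^ p ^ k = 1 := by simpa [Subtype.ext_iff] using hk
  exact ⟨k, by rw [conj_pow, hk', mul_one, mul_inv_cancel]⟩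

end Chains

/-! ### The class is a hereditary formation of soluble groups. -/

section SylowClass

variable {G H : Type u} [Group G] [Finite G] [Group H] [Finite H] {t : ℕ}

theorem sylowKPt_of_surjective {f : G →* H} (hf : Function.Surjective f) (h : sylowKPt t G) :
    sylowKPt t H := by
  intro q hq Q
  have := Fact.mk hq
  obtain ⟨P, rfl⟩ := Sylow.mapSurjective_surjective hf q Q
  have h1 := KPtChain.map (h q hq P) f
  rwa [map_top_of_surjective f hf] at h1

theorem isSolvable_of_sylowKPt (h : sylowKPt t G) : Group.IsSolvable G := by
  induction hn : Nat.card G using Nat.strong_induction_on generalizing G with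
  | _ n ih =>
    rcases subsingleton_or_nontrivial G with hs | hs
    · infer_instance
    have hne : (Nat.card G).primeFactors.Nonempty :=
      Nat.nonempty_primeFactors.2 Finite.one_lt_card
    obtain ⟨p, hp, hmax⟩ := (Nat.card G).primeFactors.exists_max_image id hne
    have hpp := Nat.prime_of_mem_primeFactors hp
    have := Fact.mk hpp
    obtain ⟨P⟩ : Nonempty (Sylow p G) := inferInstance
    have hP : (P : Subgroup G).Normal := sylow_normal_of_isKPtSubnormal hpp
      (fun r hr hd => hmax r (Nat.mem_primeFactors.2 ⟨hr, hd, Nat.card_pos.ne'⟩)) P (h p hpp P)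
    have hPb : (P : Subgroup G) ≠ ⊥ := P.ne_bot_of_dvd_card (Nat.dvd_of_mem_primeFactors hp)
    have hlt : Nat.card (G ⧸ (P : Subgroup G)) < n := by
      rw [← hn, ← card_mul_index (P : Subgroup G), ← index_eq_card]
      have h1 : 1 < Nat.card (P : Subgroup G) := (one_lt_card_iff_ne_bot _).2 hPb
      exact lt_mul_of_one_lt_left (Nat.pos_of_ne_zero index_ne_zero_of_finite) h1
    have h1 : Group.IsSolvable (G ⧸ (P : Subgroup G)) :=
      ih _ hlt (sylowKPt_of_surjective (QuotientGroup.mk'_surjective _) h) rfl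
    have h2 : Group.IsNilpotent (P : Subgroup G) := P.isPGroup'.isNilpotent
    exact (Group.isSolvable_iff_subgroup_quotient (P : Subgroup G)).2 ⟨inferInstance, h1⟩

theorem isKPtSubnormal_sup_of_quotient {N : Subgroup G} [N.Normal] (h : sylowKPt t (G ⧸ N))
    {q : ℕ} (hq : q.Prime) (P : Sylow q G) : IsKPtSubnormal t ((P : Subgroup G) ⊔ N) := by
  have := Fact.mk hq
  have h1 := KPtChain.comap (h q hq (P.mapSurjective (QuotientGroup.mk'_surjective N)))
    (QuotientGroup.mk' N) (by rw [MonoidHom.range_eq_top.2 (QuotientGroup.mk'_surjective N)])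
  rwa [Sylow.coe_mapSurjective, QuotientGroup.comap_map_mk', comap_top, sup_comm] at h1

/-- An element of `PN₁ ∩ PN₂` has a q-power exponent taking it into `N₁` and another taking it into
`N₂`; their product takes it into `N₁ ∩ N₂ = 1`. -/
theorem isPGroup_inf_of_inf_eq_bot {G : Type u} [Group G] {N₁ N₂ : Subgroup G} [N₁.Normal] [N₂.Normal]
    (h : N₁ ⊓ N₂ = ⊥) {q : ℕ} {P : Subgroup G} (hP : IsPGroup q P) :
    IsPGroup q ((P ⊔ N₁) ⊓ (P ⊔ N₂) : Subgroup G) := by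
  have key : ∀ N : Subgroup G, N.Normal → ∀ x ∈ P ⊔ N, ∃ k, x ^ q ^ k ∈ N := by
    intro N hN x hx
    have h1 : IsPGroup q (P.map (QuotientGroup.mk' N)) := hP.map _
    have h2 : QuotientGroup.mk' N x ∈ P.map (QuotientGroup.mk' N) := by
      rwa [← mem_comap, QuotientGroup.comap_map_mk', sup_comm]
    obtain ⟨k, hk⟩ := (isPGroup_iff_pow_pow_eq_one.1 h1) ⟨_, h2⟩
    refine ⟨k, (QuotientGroup.eq_one_iff _).1 ?_⟩
    simpa [Subtype.ext_iff] using hk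
  rw [isPGroup_iff_pow_pow_eq_one]
  rintro ⟨x, hx⟩
  obtain ⟨k, hk⟩ := key N₁ inferInstance x hx.1
  obtain ⟨m, hm⟩ := key N₂ inferInstance x hx.2
  refine ⟨k + m, Subtype.ext ?_⟩
  have : x ^ q ^ (k + m) ∈ N₁ ⊓ N₂ := by
    constructor
    · rw [pow_add, pow_mul]
      exact N₁.pow_mem hk _
    · rw [pow_add, mul_comm, pow_mul]
      exact N₂.pow_mem hm _
  rw [h, mem_bot] at this
  simpa using this

theorem isSolvable_quotient_inf {G : Type u} [Group G] (N₁ N₂ : Subgroup G) [N₁.Normal]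
    [N₂.Normal] (h₁ : Group.IsSolvable (G ⧸ N₁)) (h₂ : Group.IsSolvable (G ⧸ N₂)) :
    Group.IsSolvable (G ⧸ (N₁ ⊓ N₂)) := by
  let f : G →* (G ⧸ N₁) × (G ⧸ N₂) := (QuotientGroup.mk' N₁).prod (QuotientGroup.mk' N₂)
  have hf : f.ker = N₁ ⊓ N₂ := by
    rw [MonoidHom.ker_prod, QuotientGroup.ker_mk', QuotientGroup.ker_mk']
  have h3 : Group.IsSolvable (G ⧸ f.ker) :=
    Group.isSolvable_of_isSolvable_injective (QuotientGroup.kerLift_injective f)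
  exact Group.isSolvable_of_surjective (f := (QuotientGroup.quotientMulEquivOfEq hf).toMonoidHom)
    (QuotientGroup.quotientMulEquivOfEq hf).surjective

theorem sylowKPt_quotient_inf (N₁ N₂ : Subgroup G) [hN₁ : N₁.Normal] [hN₂ : N₂.Normal]
    (h₁ : sylowKPt t (G ⧸ N₁)) (h₂ : sylowKPt t (G ⧸ N₂)) :
    sylowKPt t (G ⧸ (N₁ ⊓ N₂)) := by
  have hsol := isSolvable_quotient_inf N₁ N₂ (isSolvable_of_sylowKPt h₁)
    (isSolvable_of_sylowKPt h₂)
  intro q hq Q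
  have := Fact.mk hq
  let π := QuotientGroup.mk' (N₁ ⊓ N₂)
  have hπ : Function.Surjective π := QuotientGroup.mk'_surjective _
  obtain ⟨P, rfl⟩ := Sylow.mapSurjective_surjective hπ q Q
  have hchain : ∀ N : Subgroup G, [N.Normal] → sylowKPt t (G ⧸ N) →
      IsKPtSubnormal t ((P : Subgroup G).map π ⊔ N.map π) := by
    intro N _ hN
    have h := KPtChain.map (isKPtSubnormal_sup_of_quotient hN hq P) π
    rwa [map_top_of_surjective π hπ, Subgroup.map_sup] at h
  have hn₁ := hN₁.map π hπ
  have hn₂ := hN₂.map π hπ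
  have hbot : N₁.map π ⊓ N₂.map π = ⊥ := by
    rw [eq_bot_iff]
    rintro _ ⟨⟨a, ha, rfl⟩, ⟨b, hb, hab⟩⟩
    have h1 : a⁻¹ * b ∈ N₁ ⊓ N₂ := QuotientGroup.eq.1 hab.symm
    have h2 : a ∈ N₂ := by
      have := N₂.mul_mem hb (N₂.inv_mem h1.2)
      simpa using this
    exact (QuotientGroup.eq_one_iff a).2 ⟨ha, h2⟩
  have hinf := (hchain N₁ h₁).inf (hchain N₂ h₂)
  have hpg := isPGroup_inf_of_inf_eq_bot hbot (P.mapSurjective hπ).isPGroup'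
  -- Maximality of a Sylow subgroup among q-subgroups turns the inclusion in `PN₁ ∩ PN₂` into
  -- equality.
  have heq := (P.mapSurjective hπ).is_maximal' hpg (le_inf le_sup_left le_sup_left)
  rw [Sylow.coe_mapSurjective] at heq ⊢
  rwa [heq] at hinf

theorem sylowKPt_isFormation (t : ℕ) : IsFormation (sylowKPt.{u} t) where
  iso_closed := fun _ _ _ _ _ _ ⟨e⟩ h =>
    sylowKPt_of_surjective (f := e.toMonoidHom) e.surjective h
  quotient_closed := fun _ _ _ N _ h => sylowKPt_of_surjective (QuotientGroup.mk'_surjective N) h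
  inf_closed := fun _ _ _ N₁ N₂ _ _ h₁ h₂ => sylowKPt_quotient_inf N₁ N₂ h₁ h₂

theorem sylowKPt_isHereditary (t : ℕ) : IsHereditary (sylowKPt.{u} t) := by
  intro G _ _ H h q hq Q
  have := isSolvable_of_sylowKPt h
  obtain ⟨P, hP⟩ := Q.exists_comap_subtype_eq
  have h1 := (KPtChain.inf (h q hq P) H).comap H.subtype (by simp)
  rw [top_inf_eq, comap_inf, hP] at h1
  have h2 : H.comap H.subtype = ⊤ := by
    rw [eq_top_iff]
    exact fun x _ => x.2
  rwa [h2, inf_top_eq] at h1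

end SylowClass

/-! ### Coprime action of a Sylow subgroup read off from a chain. -/

section Action

variable {G : Type u} [Group G] [Finite G] {t : ℕ}

theorem commutator_mem_of_index_prime {N A : Subgroup G} [N.Normal] {r p : ℕ} (hr : r.Prime)
    (hN : IsPGroup r N) (hsup : A ⊔ N = ⊤) (hp : p.Prime) (hA : A.index = p) :
    p = r ∧ ∀ x y : G, ∀ u ∈ N, ⁅⁅x, y⁆, u⁆ ∈ A ∧ ⁅x ^ (r - 1), u⁆ ∈ A := by
  have := Fact.mk hr
  obtain ⟨n, hn⟩ := IsPGroup.iff_card.1 hN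
  have hpr : p = r := by
    have h1 := relIndex_sup_dvd_card A N
    rw [hsup, relIndex_top_right, hA, hn] at h1
    exact (Nat.prime_dvd_prime_iff_eq hp hr).1 (hp.dvd_of_dvd_pow h1)
  subst hpr
  have hrel : (A ⊓ N).relIndex N = p := by
    have h1 := card_sup_mul_card_inf A N
    rw [hsup, card_top, ← A.card_mul_index, hA, mul_assoc] at h1
    have h2 := Nat.eq_of_mul_eq_mul_left Nat.card_pos h1
    have h3 := relIndex_mul_relIndex ⊥ (A ⊓ N) N bot_le inf_le_right
    rw [relIndex_bot_left, relIndex_bot_left, ← h2, mul_comm] at h3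
    exact Nat.eq_of_mul_eq_mul_right Nat.card_pos h3
  -- `A` normalizes `A ∩ N`, and `N` does so because a subgroup of index `r` in an r-group is
  -- normal. So `N/(A ∩ N)` is a normal section of order `r`.
  have hnorm : (A ⊓ N).Normal := by
    rw [← normalizer_eq_top_iff, eq_top_iff, ← hsup, sup_le_iff]
    constructor
    · exact le_normalizer_iff.2 fun a ha k hk =>
        ⟨A.mul_mem (A.mul_mem ha hk.1) (A.inv_mem ha), ‹N.Normal›.conj_mem k hk.2 a⟩
    · rw [← normal_subgroupOf_iff_le_normalizer inf_le_right]
      refine normal_of_index_eq_minFac_card ?_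
      have hn0 : n ≠ 0 := by
        rintro rfl
        have h1 := relIndex_dvd_card (A ⊓ N) N
        rw [hrel, hn, pow_zero] at h1
        exact hp.one_lt.ne' (Nat.dvd_one.1 h1)
      rw [hn, hp.pow_minFac hn0]
      exact hrel
  exact ⟨rfl, fun x y u hu =>
    have h := commutator_mem_of_relIndex_prime hp hrel x y u hu
    ⟨h.1.1, h.2.1⟩⟩

theorem commutator_mem_of_isKPtStep {N P A B : Subgroup G} [hN : N.Normal] {r : ℕ} (hr : r.Prime)
    (hNr : IsPGroup r N) (hPA : P ≤ A) (hB : B ≤ P ⊔ N) (h : IsKPtStep t A B) :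
    (∀ x ∈ P, ∀ u ∈ B ⊓ N, ⁅x, u⁆ ∈ A) ∨
      (PowerFree t (r - 1) ∧ ∀ x ∈ P, ∀ y ∈ P, ∀ u ∈ B ⊓ N,
        ⁅⁅x, y⁆, u⁆ ∈ A ∧ ⁅x ^ (r - 1), u⁆ ∈ A) := by
  obtain ⟨hAB, h | ⟨p, hp, hrel, hf⟩⟩ := h
  · left
    intro x hx u hu
    have h1 := (normal_subgroupOf_iff hAB).1 h x⁻¹ u (A.inv_mem (hPA hx)) hu.1
    have h2 := A.mul_mem (hPA hx) h1
    rwa [← mul_assoc, ← mul_assoc] at h2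
  · right
    have hsup : A.subgroupOf B ⊔ N.subgroupOf B = ⊤ := by
      rw [eq_top_iff]
      rintro ⟨b, hb⟩ -
      obtain ⟨x, hx, n, hn, rfl⟩ := mem_sup_of_normal_right.1 (hB hb)
      have hnB : n ∈ B := by simpa using B.mul_mem (B.inv_mem (hAB (hPA hx))) hb
      exact mul_mem_sup (x := (⟨x, hAB (hPA hx)⟩ : B)) (y := ⟨n, hnB⟩) (hPA hx) hn
    have hNr' : IsPGroup r (N.subgroupOf B) := hNr.comap_subtype
    obtain ⟨rfl, h1⟩ := commutator_mem_of_index_prime hr hNr' hsup hp hrel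
    refine ⟨hf, fun x hx y hy u hu => ?_⟩
    exact h1 ⟨x, hAB (hPA hx)⟩ ⟨y, hAB (hPA hy)⟩ ⟨u, hu.1⟩ hu.2

/-- Put `c = ⁅x, u⁆`. As `x` commutes with `c`, conjugating `u` by `x ^ k` gives `c ^ k * u`. At `k
= orderOf x` this yields `c ^ k = 1`, while the order of `c` also divides `|N|`; coprimality gives
`c = 1`. -/
theorem commute_of_commutator_mem {G : Type u} [Group G] {N A : Subgroup G} [hN : N.Normal] {x : G}
    (hx : (orderOf x).Coprime (Nat.card N)) (hA : ∀ c ∈ A ⊓ N, Commute x c) {u : G} (hu : u ∈ N)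
    (hxu : ⁅x, u⁆ ∈ A) : Commute x u := by
  have hcN : ⁅x, u⁆ ∈ N := N.mul_mem (hN.conj_mem u hu x) (N.inv_mem hu)
  have hc : Commute x ⁅x, u⁆ := hA _ ⟨hxu, hcN⟩
  have h1 : ∀ k : ℕ, x ^ k * u * (x ^ k)⁻¹ = ⁅x, u⁆ ^ k * u := by
    intro k
    induction k with
    | zero => simp
    | succ k ih =>
      have h2 : x ^ (k + 1) * u * (x ^ (k + 1))⁻¹ = x * (x ^ k * u * (x ^ k)⁻¹) * x⁻¹ := by
        rw [pow_succ']
        group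
      rw [h2, ih, ← mul_assoc, (hc.pow_right k).eq, pow_succ]
      simp only [commutatorElement_def, mul_assoc, inv_mul_cancel, mul_one]
  have h2 := h1 (orderOf x)
  rw [pow_orderOf_eq_one, one_mul, inv_one, mul_one, eq_comm, mul_eq_right] at h2
  have h3 : orderOf ⁅x, u⁆ ∣ Nat.card N := by
    rw [← Subgroup.orderOf_mk _ hcN]
    exact orderOf_dvd_natCard _
  have h4 := Nat.eq_one_of_dvd_coprimes hx (orderOf_dvd_of_pow_eq_one h2) h3
  exact commutatorElement_eq_one_iff_commute.1 (orderOf_eq_one_iff.1 h4)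

/-- An element acting trivially on every section `(B ∩ N)/(A ∩ N)` cut out by the chain centralizes
`N`, by coprimality; the chain starts from `P ∩ N = 1`. -/
theorem KPtChain.commute_of_forall_step {G : Type u} [Group G] {N P : Subgroup G} [hN : N.Normal]
    (hcop : (Nat.card P).Coprime (Nat.card N)) {x : G} (hx : x ∈ P)
    (hstep : ∀ A B : Subgroup G, P ≤ A → B ≤ P ⊔ N → IsKPtStep t A B →
      ∀ u ∈ B ⊓ N, ⁅x, u⁆ ∈ A) {B : Subgroup G} (h : KPtChain t P B) (hB : B ≤ P ⊔ N) :
    ∀ u ∈ B ⊓ N, Commute x u := by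
  induction h with
  | refl =>
    intro u hu
    rw [(disjoint_of_coprime_natCard hcop).eq_bot, mem_bot] at hu
    rw [hu]
    exact Commute.one_right x
  | @tail A B hPA hAB ih =>
    intro u hu
    have hxo : orderOf x ∣ Nat.card P := by
      rw [← Subgroup.orderOf_mk _ hx]
      exact orderOf_dvd_natCard _
    exact commute_of_commutator_mem (Nat.Coprime.coprime_dvd_left hxo hcop)
      (ih (hAB.1.trans hB)) hu.2 (hstep A B (KPtChain.le hPA) hB hAB u hu)

theorem KPtChain.commute_of_powerFree {N P : Subgroup G} [hN : N.Normal] {r : ℕ} (hr : r.Prime)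
    (hNr : IsPGroup r N) (hcop : (Nat.card P).Coprime (Nat.card N))
    (h : KPtChain t P (P ⊔ N)) {x y : G} (hx : x ∈ P) (hy : y ∈ P) {u : G} (hu : u ∈ N) :
    Commute ⁅x, y⁆ u ∧ Commute (x ^ (r - 1)) u := by
  have hxy : ⁅x, y⁆ ∈ P := P.mul_mem (P.mul_mem (P.mul_mem hx hy) (P.inv_mem hx)) (P.inv_mem hy)
  constructor
  · refine h.commute_of_forall_step hcop hxy (fun A B hA hB hs v hv => ?_) le_rfl u
      ⟨mem_sup_right hu, hu⟩
    rcases commutator_mem_of_isKPtStep hr hNr hA hB hs with h1 | h1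
    · exact h1 _ hxy v hv
    · exact (h1.2 x hx y hy v hv).1
  · refine h.commute_of_forall_step hcop (P.pow_mem hx _) (fun A B hA hB hs v hv => ?_) le_rfl u
      ⟨mem_sup_right hu, hu⟩
    rcases commutator_mem_of_isKPtStep hr hNr hA hB hs with h1 | h1
    · exact h1 _ (P.pow_mem hx _) v hv
    · exact (h1.2 x hx y hy v hv).2

theorem KPtChain.commute_of_not_powerFree {N P : Subgroup G} [hN : N.Normal] {r : ℕ}
    (hr : r.Prime) (hNr : IsPGroup r N) (hcop : (Nat.card P).Coprime (Nat.card N))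
    (hf : ¬ PowerFree t (r - 1)) (h : KPtChain t P (P ⊔ N)) {x : G} (hx : x ∈ P) {u : G}
    (hu : u ∈ N) : Commute x u := by
  refine h.commute_of_forall_step hcop hx (fun A B hA hB hs v hv => ?_) le_rfl u
    ⟨mem_sup_right hu, hu⟩
  rcases commutator_mem_of_isKPtStep hr hNr hA hB hs with h1 | h1
  · exact h1 x hx v hv
  · exact absurd h1.1 hf

end Action

/-! ### The values of the local function are formations. -/

section LocalFunction

variable {t : ℕ}

/-- A q-group with `q ≠ p` has no nontrivial p-subgroup, so the normal factor must be trivial; for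
`q = p` the whole group serves as that factor. -/
theorem classProduct_iff {Q : Type u} [Group Q] [Finite Q] {p q n : ℕ} (hp : p.Prime)
    (hq : q.Prime) (hQ : IsPGroup q Q) :
    classProduct (pGroups p) (abelianOfExponent n) Q ↔
      (q ≠ p → ∀ x y : Q, ⁅x, y⁆ = 1 ∧ x ^ n = 1) := by
  have := Fact.mk hp
  have := Fact.mk hq
  constructor
  · rintro ⟨N, hN, hNp, hcomm, hexp⟩ hne x y
    have hbot : N = ⊥ := disjoint_self.1
      (IsPGroup.disjoint_of_ne q p hne N N (hQ.to_subgroup N) hNp)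
    subst hbot
    constructor
    · rw [← mem_bot, ← QuotientGroup.eq_one_iff]
      exact commutatorElement_eq_one_iff_mul_comm.2 (hcomm x y)
    · rw [← mem_bot, ← QuotientGroup.eq_one_iff]
      exact Monoid.exponent_dvd_iff_forall_pow_eq_one.1 hexp x
  · intro h
    by_cases hqp : q = p
    · subst hqp
      have := QuotientGroup.subsingleton_quotient_top (G := Q)
      refine ⟨⊤, inferInstance, hQ.to_subgroup _, fun a b => Subsingleton.elim _ _, ?_⟩
      exact Monoid.exponent_dvd_iff_forall_pow_eq_one.2 fun g => Subsingleton.elim _ _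
    · refine ⟨⊥, inferInstance, IsPGroup.of_bot, ?_, ?_⟩
      · intro a b
        obtain ⟨x, rfl⟩ := QuotientGroup.mk_surjective a
        obtain ⟨y, rfl⟩ := QuotientGroup.mk_surjective b
        have h1 := commutatorElement_eq_one_iff_mul_comm.1 (h hqp x y).1
        rw [← QuotientGroup.mk_mul, h1, QuotientGroup.mk_mul]
      · refine Monoid.exponent_dvd_iff_forall_pow_eq_one.2 fun a => ?_
        obtain ⟨x, rfl⟩ := QuotientGroup.mk_surjective a
        rw [← QuotientGroup.mk_pow, (h hqp x x).2, QuotientGroup.mk_one]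

/-- Membership of a quotient becomes a condition on elements of Sylow subgroups of `G` lying in the
kernel, which passes at once to intersections of kernels. -/
theorem solubleWithSylowIn_iff_of_surjective {G H : Type u} [Group G] [Finite G] [Group H]
    [Finite H] {f : G →* H} (hf : Function.Surjective f) {p : ℕ} (hp : p.Prime) {n : ℕ} :
    solubleWithSylowIn (classProduct (pGroups p) (abelianOfExponent n)) H ↔
      Group.IsSolvable H ∧ ∀ q : ℕ, q.Prime → q ≠ p → ∀ P : Sylow q G, ∀ x ∈ P, ∀ y ∈ P,
        f ⁅x, y⁆ = 1 ∧ f (x ^ n) = 1 := by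
  refine and_congr Iff.rfl (forall_congr' fun q => forall_congr' fun hq => ?_)
  have := Fact.mk hq
  constructor
  · intro h hne P x hx y hy
    have h1 := (classProduct_iff hp hq (P.mapSurjective hf).isPGroup').1
      (h (P.mapSurjective hf)) hne ⟨f x, mem_map_of_mem f hx⟩ ⟨f y, mem_map_of_mem f hy⟩
    rw [map_commutatorElement, map_pow]
    exact ⟨congrArg Subtype.val h1.1, congrArg Subtype.val h1.2⟩
  · intro h Q
    obtain ⟨P, rfl⟩ := Sylow.mapSurjective_surjective hf q Q
    refine (classProduct_iff hp hq (P.mapSurjective hf).isPGroup').2 ?_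
    rintro hne ⟨_, x, hx, rfl⟩ ⟨_, y, hy, rfl⟩
    have h1 := h hne P x hx y hy
    rw [map_commutatorElement, map_pow] at h1
    exact ⟨Subtype.ext h1.1, Subtype.ext h1.2⟩

theorem solubleWithSylowIn_of_surjective {G H : Type u} [Group G] [Finite G] [Group H]
    [Finite H] {f : G →* H} (hf : Function.Surjective f) {p : ℕ} (hp : p.Prime) {n : ℕ}
    (h : solubleWithSylowIn (classProduct (pGroups p) (abelianOfExponent n)) G) :
    solubleWithSylowIn (classProduct (pGroups p) (abelianOfExponent n)) H := by
  have : Group.IsSolvable G := h.1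
  have h1 := (solubleWithSylowIn_iff_of_surjective (f := MonoidHom.id G)
    Function.surjective_id hp).1 h
  refine (solubleWithSylowIn_iff_of_surjective hf hp).2
    ⟨Group.isSolvable_of_surjective hf, fun q hq hne P x hx y hy => ?_⟩
  have h2 := h1.2 q hq hne P x hx y hy
  rw [MonoidHom.id_apply, MonoidHom.id_apply] at h2
  rw [h2.1, h2.2, map_one]
  exact ⟨rfl, rfl⟩

theorem solubleWithSylowIn_isFormation {p : ℕ} (hp : p.Prime) (n : ℕ) :
    IsFormation.{u} (solubleWithSylowIn (classProduct (pGroups p) (abelianOfExponent n))) where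
  iso_closed := fun _ _ _ _ _ _ ⟨e⟩ h =>
    solubleWithSylowIn_of_surjective (f := e.toMonoidHom) e.surjective hp h
  quotient_closed := fun _ _ _ N _ h =>
    solubleWithSylowIn_of_surjective (QuotientGroup.mk'_surjective N) hp h
  inf_closed := fun G _ _ N₁ N₂ _ _ h₁ h₂ => by
    have h₁' := (solubleWithSylowIn_iff_of_surjective (QuotientGroup.mk'_surjective N₁) hp).1 h₁
    have h₂' := (solubleWithSylowIn_iff_of_surjective (QuotientGroup.mk'_surjective N₂) hp).1 h₂
    refine (solubleWithSylowIn_iff_of_surjective (QuotientGroup.mk'_surjective (N₁ ⊓ N₂)) hp).2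
      ⟨isSolvable_quotient_inf N₁ N₂ h₁.1 h₂.1, fun q hq hne P x hx y hy => ?_⟩
    have h3 := h₁'.2 q hq hne P x hx y hy
    have h4 := h₂'.2 q hq hne P x hx y hy
    simp only [QuotientGroup.mk'_apply, QuotientGroup.eq_one_iff] at h3 h4 ⊢
    exact ⟨⟨h3.1, h4.1⟩, ⟨h3.2, h4.2⟩⟩

theorem pGroups_isFormation (p : ℕ) : IsFormation.{u} (pGroups p) where
  iso_closed := fun _ _ _ _ _ _ ⟨e⟩ h => IsPGroup.of_equiv h e
  quotient_closed := fun _ _ _ N _ h => IsPGroup.to_quotient h N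
  inf_closed := fun G _ _ N₁ N₂ _ _ h₁ h₂ => by
    refine isPGroup_iff_pow_pow_eq_one.2 fun a => ?_
    obtain ⟨x, rfl⟩ := QuotientGroup.mk_surjective a
    obtain ⟨k, hk⟩ := isPGroup_iff_pow_pow_eq_one.1 h₁ x
    obtain ⟨m, hm⟩ := isPGroup_iff_pow_pow_eq_one.1 h₂ x
    rw [← QuotientGroup.mk_pow, QuotientGroup.eq_one_iff] at hk hm
    refine ⟨k + m, ?_⟩
    rw [← QuotientGroup.mk_pow, QuotientGroup.eq_one_iff]
    constructor
    · rw [pow_add, pow_mul]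
      exact N₁.pow_mem hk _
    · rw [pow_add, mul_comm, pow_mul]
      exact N₂.pow_mem hm _

theorem localF_isLocalFunction (t : ℕ) : IsLocalFunction (localF.{u} t) := by
  intro p
  unfold localF
  split_ifs
  · exact solubleWithSylowIn_isFormation p.2 _
  · exact pGroups_isFormation p

end LocalFunction

/-! ### Chief factors, and the inclusion of the class in the local formation. -/

section ChiefFactors

variable {G : Type u} [Group G] {t : ℕ}

theorem mem_factorCentralizer {H K : Subgroup G} [K.Normal] {x : G} :
    x ∈ factorCentralizer H K ↔ ∀ v ∈ H.map (QuotientGroup.mk' K),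
      Commute (QuotientGroup.mk' K x) v := by
  rw [factorCentralizer, mem_comap, mem_centralizer_iff]
  exact forall₂_congr fun v _ => eq_comm

theorem IsChiefFactor.isMinimalNormal {H K : Subgroup G} [hH : H.Normal] [K.Normal]
    (h : IsChiefFactor H K) : IsMinimalNormal (H.map (QuotientGroup.mk' K)) := by
  have hs := QuotientGroup.mk'_surjective K
  refine ⟨hH.map _ hs, fun hb => ?_, fun L hL hLH => ?_⟩
  · rw [Subgroup.map_eq_bot_iff, QuotientGroup.ker_mk'] at hb
    exact h.1.not_ge hb
  · have hKL : K ≤ L.comap (QuotientGroup.mk' K) := by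
      conv_lhs => rw [← QuotientGroup.ker_mk' K]
      exact MonoidHom.ker_le_comap _ _
    have hLH' : L.comap (QuotientGroup.mk' K) ≤ H := by
      refine (comap_mono hLH).trans ?_
      rw [QuotientGroup.comap_map_mk', sup_eq_right.2 h.1.le]
    rw [← map_comap_eq_self_of_surjective hs L]
    rcases h.2 _ (hL.comap _) hKL hLH' with h1 | h1
    · left
      rw [h1, Subgroup.map_eq_bot_iff, QuotientGroup.ker_mk']
    · right
      rw [h1]

theorem exists_isChiefFactor [Finite G] {K : Subgroup G} [hK : K.Normal] (h : K ≠ ⊤) :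
    ∃ (H : Subgroup G) (_ : H.Normal), IsChiefFactor H K := by
  obtain ⟨H, hH⟩ := (Set.toFinite {L : Subgroup G | L.Normal ∧ K < L}).exists_minimal
    ⟨⊤, inferInstance, lt_top_iff_ne_top.2 h⟩
  refine ⟨H, hH.1.1, hH.1.2, fun L hL hKL hLH => ?_⟩
  rcases hKL.eq_or_lt with h1 | h1
  · exact Or.inl h1.symm
  · exact Or.inr (le_antisymm hLH (hH.2 ⟨hL, h1⟩ hLH))

theorem card_map_mk'_eq_relIndex (H K : Subgroup G) [K.Normal] :
    Nat.card (H.map (QuotientGroup.mk' K)) = K.relIndex H := by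
  rw [← relIndex_ker, QuotientGroup.ker_mk']

theorem isPGroup_of_forall_sylow_eq_bot [Finite G] {p : ℕ}
    (h : ∀ q : ℕ, q.Prime → q ≠ p → ∀ P : Sylow q G, (P : Subgroup G) = ⊥) : IsPGroup p G := by
  refine IsPGroup.of_card (n := _) (Nat.eq_prime_pow_of_unique_prime_dvd Nat.card_pos.ne' ?_)
  intro q hq hd
  by_contra hne
  have := Fact.mk hq
  obtain ⟨P⟩ : Nonempty (Sylow q G) := inferInstance
  exact P.ne_bot_of_dvd_card hd (h q hq hne P)

theorem localF_of_powerFree {p : Nat.Primes} (h : PowerFree t ((p : ℕ) - 1)) :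
    localF.{u} t p =
      solubleWithSylowIn (classProduct (pGroups p) (abelianOfExponent ((p : ℕ) - 1))) := by
  rw [localF, if_pos h]

theorem localF_of_not_powerFree {p : Nat.Primes} (h : ¬ PowerFree t ((p : ℕ) - 1)) :
    localF.{u} t p = pGroups p := by
  rw [localF, if_neg h]

/-- The inclusion of the class in the local formation of `localF`. -/
theorem LF_localF_of_sylowKPt [Finite G] (h : sylowKPt t G) : LF (localF t) G := by
  intro H K hH hK hHK p hd
  have := isSolvable_of_sylowKPt h
  have hsurj := QuotientGroup.mk'_surjective K
  have hsurjC := QuotientGroup.mk'_surjective (factorCentralizer H K)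
  have hsol : Group.IsSolvable (G ⧸ K) := Group.isSolvable_of_surjective hsurj
  have hmin := hHK.isMinimalNormal
  have hnorm := hmin.normal
  have hN : IsPGroup p (H.map (QuotientGroup.mk' K)) :=
    hmin.isPGroup hmin.comm p.2 (by rwa [card_map_mk'_eq_relIndex])
  have hpF := Fact.mk p.2
  have key : ∀ q : ℕ, q.Prime → q ≠ p → ∀ P : Sylow q G,
      (Nat.card ((P : Subgroup G).map (QuotientGroup.mk' K))).Coprime
        (Nat.card (H.map (QuotientGroup.mk' K))) ∧
      KPtChain t ((P : Subgroup G).map (QuotientGroup.mk' K))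
        ((P : Subgroup G).map (QuotientGroup.mk' K) ⊔ H.map (QuotientGroup.mk' K)) := by
    intro q hq hne P
    have := Fact.mk hq
    refine ⟨IsPGroup.coprime_card_of_ne q p hne _ _ (P.isPGroup'.map _) hN, ?_⟩
    -- Intersecting the chain from `PK/K` to `G/K` with the product of `PK/K` and `H/K` makes it end
    -- at that product.
    have h1 := KPtChain.inf (sylowKPt_of_surjective hsurj h q hq (P.mapSurjective hsurj))
      ((P : Subgroup G).map (QuotientGroup.mk' K) ⊔ H.map (QuotientGroup.mk' K))
    rwa [Sylow.coe_mapSurjective, inf_eq_left.2 le_sup_left, top_inf_eq] at h1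
  by_cases hf : PowerFree t ((p : ℕ) - 1)
  · rw [localF_of_powerFree hf]
    refine (solubleWithSylowIn_iff_of_surjective hsurjC p.2).2
      ⟨Group.isSolvable_of_surjective hsurjC, fun q hq hne P x hx y hy => ?_⟩
    obtain ⟨hcop, hch⟩ := key q hq hne P
    have h1 : ∀ v ∈ H.map (QuotientGroup.mk' K), _ := fun v hv =>
      hch.commute_of_powerFree p.2 hN hcop (mem_map_of_mem _ hx) (mem_map_of_mem _ hy) hv
    constructor
    · refine (QuotientGroup.eq_one_iff _).2 (mem_factorCentralizer.2 fun v hv => ?_)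
      rw [map_commutatorElement]
      exact (h1 v hv).1
    · refine (QuotientGroup.eq_one_iff _).2 (mem_factorCentralizer.2 fun v hv => ?_)
      rw [map_pow]
      exact (h1 v hv).2
  · rw [localF_of_not_powerFree hf]
    refine isPGroup_of_forall_sylow_eq_bot fun q hq hne Q => ?_
    have := Fact.mk hq
    obtain ⟨P, rfl⟩ := Sylow.mapSurjective_surjective hsurjC q Q
    obtain ⟨hcop, hch⟩ := key q hq hne P
    rw [Sylow.coe_mapSurjective, Subgroup.map_eq_bot_iff, QuotientGroup.ker_mk']
    exact fun x hx => mem_factorCentralizer.2 fun v hv =>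
      hch.commute_of_not_powerFree p.2 hN hcop hf (mem_map_of_mem _ hx) hv

end ChiefFactors

/-! ### Abelian actions of exponent dividing `r - 1` on elementary abelian r-groups. -/

section Diagonalizable

variable {t : ℕ}

/-- The minimal polynomial divides `X ^ r - X`, which splits over the field of `r` elements, so
there is an eigenvector. The eigenvalue is a natural number so that it can become an exponent
multiplicatively. -/
theorem exists_apply_eq_nsmul {V : Type u} [AddCommGroup V] [Finite V] [Nontrivial V] {r : ℕ}
    [Fact r.Prime] [Module (ZMod r) V] (A : Module.End (ZMod r) V)
    (h : ∀ v, A^[r - 1] v = v) :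
    ∃ n : ℕ, ∃ v : V, v ≠ 0 ∧ A v = n • v := by
  have hr : r.Prime := Fact.out
  have hfin : Module.Finite (ZMod r) V := Module.Finite.of_finite
  have hA : A ^ (r - 1) = 1 := by
    ext v
    rw [Module.End.pow_apply, h]
    rfl
  have hA1 : A ^ r = A := by
    rw [← pow_sub_one_mul hr.ne_zero, hA, one_mul]
  have hdvd : minpoly (ZMod r) A ∣ Polynomial.X ^ r - Polynomial.X := by
    refine minpoly.dvd _ _ ?_
    simp [hA1]
  have hsplit : (minpoly (ZMod r) A).Splits := by
    have h1 := Polynomial.splits_X_pow_nat_card_sub_X (K := ZMod r)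
    rw [Nat.card_zmod] at h1
    exact h1.of_dvd (FiniteField.X_pow_card_sub_X_ne_zero _ hr.one_lt) hdvd
  obtain ⟨μ, hμ⟩ := hsplit.exists_eval_eq_zero
    (minpoly.degree_pos (Algebra.IsIntegral.isIntegral A)).ne'
  obtain ⟨v, hv⟩ := (Module.End.hasEigenvalue_of_isRoot hμ).exists_hasEigenvector
  refine ⟨μ.val, v, hv.2, ?_⟩
  rw [hv.apply_eq_smul]
  conv_lhs => rw [← ZMod.natCast_zmod_val μ, Nat.cast_smul_eq_nsmul]

theorem exists_addMonoidHom_apply_eq_nsmul {V : Type u} [AddCommGroup V] [Finite V] [Nontrivial V]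
    {r : ℕ} (hr : r.Prime) (hV : ∀ v : V, r • v = 0) (f : V →+ V) (h : ∀ v, f^[r - 1] v = v) :
    ∃ n : ℕ, ∃ v : V, v ≠ 0 ∧ f v = n • v := by
  have := Fact.mk hr
  let _ : Module (ZMod r) V := AddCommGroup.zmodModule hV
  exact exists_apply_eq_nsmul (f.toZModLinearMap r) h

theorem exists_map_eq_pow {V : Type u} [CommGroup V] [Finite V] [Nontrivial V] {r : ℕ}
    (hr : r.Prime) (hV : ∀ v : V, v ^ r = 1) (e : MulAut V) (he : e ^ (r - 1) = 1) :
    ∃ n : ℕ, ∃ v : V, v ≠ 1 ∧ e v = v ^ n := by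
  have hA : ∀ (k : ℕ) (v : Additive V), (e.toMonoidHom.toAdditive)^[k] v =
      Additive.ofMul ((e ^ k) v.toMul) := by
    intro k
    induction k with
    | zero => intro v; rfl
    | succ k ih =>
      intro v
      rw [Function.iterate_succ_apply', ih, pow_succ']
      rfl
  obtain ⟨n, v, hv, hn⟩ := exists_addMonoidHom_apply_eq_nsmul (V := Additive V) hr
    (fun v => hV v.toMul) e.toMonoidHom.toAdditive fun v => by
      rw [hA, he]
      rfl
  exact ⟨n, v.toMul, hv, hn⟩

variable {G : Type u} [Group G]

/-- The eigenspace `L` of `x` in `W` is nontrivial. It is normalized by `P`, whose action is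
abelian, and by the abelian `N`, hence by `G = PN`; minimality gives `L = W`. -/
theorem IsMinimalNormal.exists_conj_eq_pow [Finite G] {W N P : Subgroup G}
    (hW : IsMinimalNormal W) (hWN : W ≤ N) (hPN : P ⊔ N = ⊤)
    (hcomm : ∀ x ∈ N, ∀ y ∈ N, x * y = y * x) {r : ℕ} (hr : r.Prime) (hexp : ∀ x ∈ N, x ^ r = 1)
    (hP : ∀ x ∈ P, ∀ y ∈ P, ∀ u ∈ N, Commute ⁅x, y⁆ u ∧ Commute (x ^ (r - 1)) u) {x : G}
    (hx : x ∈ P) : ∃ n : ℕ, ∀ w ∈ W, x * w * x⁻¹ = w ^ n := by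
  have := hW.normal
  let _ : CommGroup W :=
    { (inferInstance : Group W) with
      mul_comm := fun a b => Subtype.ext (hcomm a (hWN a.2) b (hWN b.2)) }
  have : Nontrivial W := (nontrivial_iff_ne_bot W).2 hW.ne_bot
  obtain ⟨n, v, hv1, hv⟩ := exists_map_eq_pow (V := W) hr
    (fun v => Subtype.ext (by simpa using hexp v (hWN v.2))) (MulAut.conjNormal x) (by
      rw [← map_pow]
      ext w
      rw [MulAut.conjNormal_apply, ((hP x hx x hx w (hWN w.2)).2).eq, mul_inv_cancel_right]
      rfl)
  have hv' : x * v * x⁻¹ = (v : G) ^ n := by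
    rw [← MulAut.conjNormal_apply, hv]
    rfl
  refine ⟨n, ?_⟩
  let L : Subgroup G :=
    { carrier := {w | w ∈ W ∧ x * w * x⁻¹ = w ^ n}
      one_mem' := ⟨one_mem _, by simp⟩
      mul_mem' := fun {a b} ha hb => ⟨mul_mem ha.1 hb.1, by
        have h1 : Commute a b := hcomm a (hWN ha.1) b (hWN hb.1)
        rw [h1.mul_pow, ← ha.2, ← hb.2]
        group⟩
      inv_mem' := fun {a} ha => ⟨inv_mem ha.1, by
        rw [inv_pow, ← ha.2]
        group⟩ }
  have hL : L.Normal := by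
    rw [← normalizer_eq_top_iff, eq_top_iff, ← hPN, sup_le_iff]
    constructor
    · refine le_normalizer_iff.2 fun y hy w hw => ⟨hW.normal.conj_mem w hw.1 y, ?_⟩
      have h1 := (hP x⁻¹ (P.inv_mem hx) y⁻¹ (P.inv_mem hy) w (hWN hw.1)).1
      -- This is `x * y = y * x * ⁅x⁻¹, y⁻¹⁆`, where the commutator centralizes `w`.
      have h2 : x * (y * w * y⁻¹) * x⁻¹ = y * x * (⁅x⁻¹, y⁻¹⁆ * w * ⁅x⁻¹, y⁻¹⁆⁻¹) * x⁻¹ * y⁻¹ := by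
        rw [commutatorElement_def]
        group
      rw [h2, h1.eq, mul_inv_cancel_right, conj_pow, ← hw.2]
      group
    · refine le_normalizer_iff.2 fun m hm w hw => ?_
      rwa [hcomm m hm w (hWN hw.1), mul_inv_cancel_right]
  rcases hW.eq_bot_or_eq L hL (fun w hw => hw.1) with h | h
  · have h1 : (v : G) ∈ L := ⟨v.2, hv'⟩
    rw [h, mem_bot] at h1
    exact absurd (Subtype.ext h1) hv1
  · intro w hw
    rw [← h] at hw
    exact hw.2

/-- Elements of `P` act on `W` as power maps, so every cyclic subgroup of `W` is normal in `G`. -/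
theorem IsMinimalNormal.card_eq_prime [Finite G] {W N P : Subgroup G}
    (hW : IsMinimalNormal W) (hWN : W ≤ N) (hPN : P ⊔ N = ⊤)
    (hcomm : ∀ x ∈ N, ∀ y ∈ N, x * y = y * x) {r : ℕ} (hr : r.Prime) (hexp : ∀ x ∈ N, x ^ r = 1)
    (hP : ∀ x ∈ P, ∀ y ∈ P, ∀ u ∈ N, Commute ⁅x, y⁆ u ∧ Commute (x ^ (r - 1)) u) :
    Nat.card W = r := by
  obtain ⟨w, hw, hw1⟩ := W.bot_or_exists_ne_one.resolve_left hW.ne_bot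
  have hZ : (zpowers w).Normal := by
    rw [← normalizer_eq_top_iff, eq_top_iff, ← hPN, sup_le_iff]
    constructor
    · refine le_normalizer_iff.2 fun x hx u hu => ?_
      obtain ⟨n, hn⟩ := hW.exists_conj_eq_pow hWN hPN hcomm hr hexp hP hx
      rw [hn u ((zpowers_le.2 hw) hu)]
      exact pow_mem hu n
    · refine le_normalizer_iff.2 fun m hm u hu => ?_
      rwa [hcomm m hm u (hWN ((zpowers_le.2 hw) hu)), mul_inv_cancel_right]
  rcases hW.eq_bot_or_eq _ hZ (zpowers_le.2 hw) with h | h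
  · exact absurd (zpowers_eq_bot.1 h) hw1
  · have := Fact.mk hr
    rw [← h, Nat.card_zpowers]
    exact orderOf_eq_prime (hexp w (hWN hw)) hw1

theorem kptChain_sup_of_commute [Finite G] {N P : Subgroup G} [hN : N.Normal]
    (h : ∀ x ∈ P, ∀ u ∈ N, Commute x u) : KPtChain t P (P ⊔ N) := by
  refine .single (isKPtStep_of_conj_mem le_sup_left fun a ha b hb => ?_)
  obtain ⟨x, hx, u, hu, rfl⟩ := mem_sup_of_normal_right.1 hb
  have h1 : x * u * a * (x * u)⁻¹ = x * a * x⁻¹ := by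
    rw [mul_assoc x u a, (h a ha u hu).symm.eq]
    group
  rw [h1]
  exact P.mul_mem (P.mul_mem hx ha) (P.inv_mem hx)

theorem kptChain_sup_of_diagonalizable [Finite G] {N P : Subgroup G} [hN : N.Normal]
    (hcomm : ∀ x ∈ N, ∀ y ∈ N, x * y = y * x) {r : ℕ} (hr : r.Prime) (hexp : ∀ x ∈ N, x ^ r = 1)
    (hf : PowerFree t (r - 1))
    (hP : ∀ x ∈ P, ∀ y ∈ P, ∀ u ∈ N, Commute ⁅x, y⁆ u ∧ Commute (x ^ (r - 1)) u) :
    KPtChain t P (P ⊔ N) := by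
  induction hn : Nat.card G using Nat.strong_induction_on generalizing G with
  | _ n ih =>
    by_cases hNb : N = ⊥
    · rw [hNb, sup_bot_eq]
    by_cases htop : P ⊔ N = ⊤
    · obtain ⟨W, hW, hWN⟩ := exists_isMinimalNormal_le N hNb
      have := hW.normal
      have hcard := hW.card_eq_prime hWN htop hcomm hr hexp hP
      have hsurj := QuotientGroup.mk'_surjective W
      have hN' : (N.map (QuotientGroup.mk' W)).Normal := hN.map _ hsurj
      have hlt : Nat.card (G ⧸ W) < n := by
        rw [← hn, ← card_mul_index W, ← index_eq_card, hcard]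
        exact lt_mul_of_one_lt_left (Nat.pos_of_ne_zero index_ne_zero_of_finite) hr.one_lt
      have h1 : KPtChain t (P.map (QuotientGroup.mk' W))
          (P.map (QuotientGroup.mk' W) ⊔ N.map (QuotientGroup.mk' W)) := by
        refine ih _ hlt ?_ ?_ ?_ rfl
        · rintro _ ⟨x, hx, rfl⟩ _ ⟨y, hy, rfl⟩
          rw [← map_mul, hcomm x hx y hy, map_mul]
        · rintro _ ⟨x, hx, rfl⟩
          rw [← map_pow, hexp x hx, map_one]
        · rintro _ ⟨x, hx, rfl⟩ _ ⟨y, hy, rfl⟩ _ ⟨u, hu, rfl⟩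
          rw [← map_commutatorElement, ← map_pow]
          exact ⟨(hP x hx y hy u hu).1.map _, (hP x hx y hy u hu).2.map _⟩
      have h2 := h1.comap (QuotientGroup.mk' W)
        (by rw [MonoidHom.range_eq_top.2 hsurj]; exact le_top)
      rw [← Subgroup.map_sup, QuotientGroup.comap_map_mk', QuotientGroup.comap_map_mk',
        sup_comm W, sup_comm W, sup_assoc, sup_eq_left.2 hWN] at h2
      -- The chain begins with `P ≤ PW`, of index dividing `|W| = r`, and continues with the
      -- preimage of the chain in `G/W`.
      refine .trans (.single ?_) h2
      exact isKPtStep_of_relIndex_dvd le_sup_left hr (hcard ▸ relIndex_sup_dvd_card P W) hf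
    · have hlt : Nat.card (P ⊔ N : Subgroup G) < n := by
        rw [← hn]
        exact lt_of_le_of_ne (card_le_card_group _) fun h => htop (card_eq_iff_eq_top _ |>.1 h)
      have h1 : KPtChain t (P.subgroupOf (P ⊔ N))
          (P.subgroupOf (P ⊔ N) ⊔ N.subgroupOf (P ⊔ N)) := by
        refine ih _ hlt ?_ ?_ ?_ rfl
        · exact fun x hx y hy => Subtype.ext (hcomm x hx y hy)
        · exact fun x hx => Subtype.ext (hexp x hx)
        · exact fun x hx y hy u hu => ⟨Subtype.ext (hP x hx y hy u hu).1,
            Subtype.ext (hP x hx y hy u hu).2⟩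
      have h2 := h1.map (P ⊔ N).subtype
      rwa [Subgroup.map_sup, subgroupOf_map_subtype, subgroupOf_map_subtype,
        inf_eq_left.2 le_sup_left, inf_eq_left.2 le_sup_right] at h2

end Diagonalizable

/-! ### The local formation lies in the class. -/

section LocalToSylow

variable {G : Type u} [Group G] [Finite G] {t : ℕ}

theorem soluble_of_localF {p : Nat.Primes} (h : localF t p G) : Group.IsSolvable G := by
  have := Fact.mk p.2
  by_cases hf : PowerFree t ((p : ℕ) - 1)
  · rw [localF_of_powerFree hf] at h
    exact h.1
  · rw [localF_of_not_powerFree hf] at h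
    have : Group.IsNilpotent G := IsPGroup.isNilpotent h
    infer_instance

/-- `G` is not yet known to be soluble. If `H/K` were perfect, the image of `H` in the soluble group
`G/C_G(H/K)` would be perfect, hence trivial, and `H` would centralize `H/K`. -/
theorem IsChiefFactor.comm_of_isSolvable {G : Type u} [Group G] {H K : Subgroup G}
    [H.Normal] [K.Normal] (hHK : IsChiefFactor H K) (hsol : Group.IsSolvable (G ⧸ factorCentralizer H K)) :
    ∀ x ∈ H.map (QuotientGroup.mk' K), ∀ y ∈ H.map (QuotientGroup.mk' K), x * y = y * x := by
  have hmin := hHK.isMinimalNormal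
  have := hmin.normal
  rcases hmin.eq_bot_or_eq ⁅H.map (QuotientGroup.mk' K), H.map (QuotientGroup.mk' K)⁆
    inferInstance (commutator_le_left _ _) with h | h
  · intro x hx y hy
    exact mem_centralizer_iff.1 (commutator_eq_bot_iff_le_centralizer.1 h hy) x hx
  · have hKC : K ≤ factorCentralizer H K := by
      intro x hx
      refine mem_factorCentralizer.2 fun v _ => ?_
      have h1 : QuotientGroup.mk' K x = 1 := (QuotientGroup.eq_one_iff x).2 hx
      rw [h1]
      exact Commute.one_left v
    have h1 : H = K ⊔ ⁅H, H⁆ := by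
      rw [← map_commutator] at h
      have h2 := congrArg (comap (QuotientGroup.mk' K)) h
      rw [QuotientGroup.comap_map_mk', QuotientGroup.comap_map_mk', sup_eq_right.2 hHK.1.le] at h2
      exact h2.symm
    have h3 : H.map (QuotientGroup.mk' (factorCentralizer H K)) =
        ⁅H.map (QuotientGroup.mk' (factorCentralizer H K)),
          H.map (QuotientGroup.mk' (factorCentralizer H K))⁆ := by
      refine (congrArg (map (QuotientGroup.mk' (factorCentralizer H K))) h1).trans ?_
      rw [Subgroup.map_sup, map_commutator,
        (Subgroup.map_eq_bot_iff K).2 (by rwa [QuotientGroup.ker_mk']), bot_sup_eq]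
    have h4 : H ≤ factorCentralizer H K := by
      by_contra hne
      refine (Group.IsSolvable.commutator_lt_of_ne_bot (H := H.map
        (QuotientGroup.mk' (factorCentralizer H K))) fun hb => hne ?_).ne h3.symm
      rwa [Subgroup.map_eq_bot_iff, QuotientGroup.ker_mk'] at hb
    rintro _ ⟨x, hx, rfl⟩ y hy
    exact mem_factorCentralizer.1 (h4 hx) y hy

theorem sylow_sup_eq_of_isPGroup {G : Type u} [Group G] {N : Subgroup G} [N.Normal] {q : ℕ}
    (hN : IsPGroup q N) (P : Sylow q G) : (P : Subgroup G) ⊔ N = P :=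
  sup_eq_left.2 (hN.le_sylow_of_normal P)

theorem IsChiefFactor.kptChain_of_LF (h : LF (localF t) G) {H K : Subgroup G} [hH : H.Normal]
    [hK : K.Normal] (hHK : IsChiefFactor H K) {q : ℕ} (hq : q.Prime) (P : Sylow q G) :
    KPtChain t ((P : Subgroup G) ⊔ K) ((P : Subgroup G) ⊔ H) := by
  have := Fact.mk hq
  have hsurj := QuotientGroup.mk'_surjective K
  have hsurjC := QuotientGroup.mk'_surjective (factorCentralizer H K)
  have hmin := hHK.isMinimalNormal
  have := hmin.normal
  have hne : K.relIndex H ≠ 1 := fun h1 => hHK.1.not_ge (relIndex_eq_one.1 h1)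
  obtain ⟨p, hp, hd⟩ := Nat.exists_prime_and_dvd hne
  have hF := h H K hHK ⟨p, hp⟩ hd
  have hcomm := hHK.comm_of_isSolvable (soluble_of_localF hF)
  rw [← card_map_mk'_eq_relIndex] at hd
  have hexp := hmin.pow_eq_one hcomm hp hd
  have hpg := hmin.isPGroup hcomm hp hd
  suffices hch : KPtChain t ((P : Subgroup G).map (QuotientGroup.mk' K))
      ((P : Subgroup G).map (QuotientGroup.mk' K) ⊔ H.map (QuotientGroup.mk' K)) by
    have h1 := hch.comap (QuotientGroup.mk' K)
      (by rw [MonoidHom.range_eq_top.2 hsurj]; exact le_top)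
    rwa [← Subgroup.map_sup, QuotientGroup.comap_map_mk', QuotientGroup.comap_map_mk',
      sup_comm K, sup_comm K, sup_assoc, sup_eq_left.2 hHK.1.le] at h1
  by_cases hqp : q = p
  · subst hqp
    have h1 := sylow_sup_eq_of_isPGroup hpg (P.mapSurjective hsurj)
    rw [Sylow.coe_mapSurjective] at h1
    rw [h1]
  by_cases hf : PowerFree t (p - 1)
  · rw [localF_of_powerFree (p := ⟨p, hp⟩) hf] at hF
    have h1 := ((solubleWithSylowIn_iff_of_surjective hsurjC hp).1 hF).2 q hq hqp P
    refine kptChain_sup_of_diagonalizable hcomm hp hexp hf ?_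
    rintro _ ⟨x, hx, rfl⟩ _ ⟨y, hy, rfl⟩ u hu
    have h2 := h1 x hx y hy
    rw [QuotientGroup.mk'_apply, QuotientGroup.mk'_apply, QuotientGroup.eq_one_iff,
      QuotientGroup.eq_one_iff] at h2
    rw [← map_commutatorElement, ← map_pow]
    exact ⟨mem_factorCentralizer.1 h2.1 u hu, mem_factorCentralizer.1 h2.2 u hu⟩
  · rw [localF_of_not_powerFree (p := ⟨p, hp⟩) hf] at hF
    have := Fact.mk hp
    refine kptChain_sup_of_commute ?_
    rintro _ ⟨x, hx, rfl⟩ u hu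
    have h1 : (P : Subgroup G).map (QuotientGroup.mk' (factorCentralizer H K)) = ⊥ :=
      disjoint_self.1 (IsPGroup.disjoint_of_ne q p hqp _ _ (P.isPGroup'.map _)
        (IsPGroup.to_subgroup hF _))
    rw [Subgroup.map_eq_bot_iff, QuotientGroup.ker_mk'] at h1
    exact mem_factorCentralizer.1 (h1 hx) u hu

/-- The inclusion of the local formation of `localF` in the class. -/
theorem sylowKPt_of_LF_localF (h : LF (localF t) G) : sylowKPt t G := by
  intro q hq P
  have key : ∀ K : Subgroup G, K.Normal → KPtChain t ((P : Subgroup G) ⊔ K) ⊤ := by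
    intro K
    induction K using WellFoundedGT.induction with
    | ind K ih =>
      intro hK
      by_cases htop : K = ⊤
      · rw [htop, sup_top_eq]
      · obtain ⟨H, hH, hHK⟩ := exists_isChiefFactor htop
        exact (hHK.kptChain_of_LF h hq P).trans (ih H hHK.1 hH)
  have h1 := key ⊥ inferInstance
  rwa [sup_bot_eq] at h1

end LocalToSylow

/-! ### Saturation by a minimal counterexample. -/

section Saturation

variable {G : Type u} [Group G] [Finite G] {t : ℕ}

/-- Let `S` be a Sylow p-subgroup of the preimage `L` of `T`, so that `L = SN`. The Frattini
argument gives `G = N_G(S)L = N_G(S)N`, and `N ≤ Φ(G)` can be dropped. -/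
theorem exists_normal_isPGroup_of_le_frattini {N : Subgroup G} [N.Normal] (hN : N ≤ frattini G)
    {p : ℕ} (hp : p.Prime) {T : Subgroup (G ⧸ N)} [hT : T.Normal] (hTp : IsPGroup p T)
    (hTb : T ≠ ⊥) : ∃ S : Subgroup G, S.Normal ∧ IsPGroup p S ∧ S ≠ ⊥ := by
  have := Fact.mk hp
  let π := QuotientGroup.mk' N
  have hπ : Function.Surjective π := QuotientGroup.mk'_surjective N
  let L := T.comap π
  have hL : L.Normal := hT.comap π
  obtain ⟨Q⟩ : Nonempty (Sylow p L) := inferInstance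
  let S : Subgroup G := (Q : Subgroup L).map L.subtype
  have hSp : IsPGroup p S := Q.isPGroup'.map _
  have hSL : S ≤ L := map_subtype_le _
  have hLS : L ≤ S ⊔ N := by
    rw [← relIndex_eq_one]
    obtain ⟨n, hn⟩ := IsPGroup.iff_card.1 hTp
    have h1 : (S ⊔ N).relIndex L ∣ p ^ n := by
      rw [sup_comm, ← QuotientGroup.comap_map_mk', relIndex_comap,
        map_comap_eq_self_of_surjective hπ, ← hn]
      exact relIndex_dvd_card _ _
    have h2 : ¬ p ∣ (S ⊔ N).relIndex L := by
      intro hd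
      refine Q.not_dvd_index (hd.trans ?_)
      have h3 : (Q : Subgroup L).index = S.relIndex L := by
        rw [relIndex, subgroupOf, comap_map_eq_self_of_injective L.subtype_injective]
      rw [h3]
      exact relIndex_dvd_of_le_left _ le_sup_left
    exact Nat.eq_one_of_dvd_coprimes
      (Nat.Coprime.pow_left n (hp.coprime_iff_not_dvd.2 h2)) h1 dvd_rfl
  refine ⟨S, ?_, hSp, fun hb => hTb ?_⟩
  · rw [← normalizer_eq_top_iff]
    refine frattini_nongenerating ?_
    rw [eq_top_iff, ← Sylow.normalizer_sup_eq_top Q, sup_le_iff]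
    exact ⟨le_sup_left, hLS.trans (sup_le_sup le_normalizer hN)⟩
  · rw [hb, bot_sup_eq] at hLS
    rw [← map_comap_eq_self_of_surjective hπ T, Subgroup.map_eq_bot_iff, QuotientGroup.ker_mk']
    exact hLS

/-- Otherwise `C_G(R)R/R` contains a minimal normal p-subgroup `L` of `G/R` with `p ≠ r`. The part
`M` of `C_G(R)` over `L` is a central extension of a p-group, hence nilpotent, and its Sylow
p-subgroup is a forbidden normal subgroup of `G`. -/
theorem centralizer_le_of_normal_sylow [Group.IsSolvable G] {r : ℕ} (hr : r.Prime)
    (hno : ∀ p : ℕ, p.Prime → p ≠ r → ∀ T : Subgroup G, T.Normal → IsPGroup p T → T = ⊥)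
    (R : Sylow r G) [hR : (R : Subgroup G).Normal] :
    centralizer (R : Set G) ≤ R := by
  have := Fact.mk hr
  by_contra hC
  let π := QuotientGroup.mk' (R : Subgroup G)
  have hπ : Function.Surjective π := QuotientGroup.mk'_surjective _
  have hCn : (centralizer ((R : Subgroup G) : Set G)).Normal := inferInstance
  have hCb : (centralizer ((R : Subgroup G) : Set G)).map π ≠ ⊥ := by
    rw [Ne, Subgroup.map_eq_bot_iff, QuotientGroup.ker_mk']
    exact hC
  have := hCn.map π hπ
  have hsol : Group.IsSolvable (G ⧸ (R : Subgroup G)) := Group.isSolvable_of_surjective hπ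
  obtain ⟨L, hL, hLC⟩ := exists_isMinimalNormal_le _ hCb
  have hLn := hL.normal
  obtain ⟨p, hp, hd⟩ := Nat.exists_prime_and_dvd (fun h1 => hL.ne_bot (card_eq_one.1 h1))
  have := Fact.mk hp
  have hLp := hL.isPGroup hL.comm hp hd
  have hpr : p ≠ r := by
    rintro rfl
    exact R.not_dvd_index ((hd.trans (card_subgroup_dvd_card L)).trans
      (index_eq_card (R : Subgroup G) ▸ dvd_rfl))
  let M : Subgroup G := L.comap π ⊓ centralizer ((R : Subgroup G) : Set G)
  have hM : M.Normal := by
    have := hLn.comap π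
    exact normal_inf_normal _ _
  have hML : M.map π = L := by
    refine le_antisymm (map_le_iff_le_comap.2 inf_le_left) fun x hx => ?_
    obtain ⟨c, hc, rfl⟩ := hLC hx
    exact mem_map_of_mem π ⟨hx, hc⟩
  let f : M →* L := (π.comp M.subtype).codRestrict L fun m => m.2.1
  have hf : f.ker ≤ center M := by
    intro m hm
    have h1 : (m : G) ∈ (R : Subgroup G) := by
      rw [← QuotientGroup.eq_one_iff]
      exact congrArg Subtype.val hm
    refine mem_center_iff.2 fun g => Subtype.ext ?_
    exact (mem_centralizer_iff.1 g.2.2 m h1).symm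
  have := hLp.isNilpotent
  have hnil : Group.IsNilpotent M := Subgroup.isNilpotent_of_ker_le_center f hf
  obtain ⟨Q⟩ : Nonempty (Sylow p M) := inferInstance
  have hQ : (Q : Subgroup M).Normal := Q.normal_of_normalizerCondition
    Group.normalizerCondition_of_isNilpotent
  have hQc := Q.characteristic_of_normal hQ
  have hQb := hno p hp hpr ((Q : Subgroup M).map M.subtype) inferInstance (Q.isPGroup'.map _)
  rw [map_eq_bot_iff_of_injective _ M.subtype_injective] at hQb
  exact Q.ne_bot_of_dvd_card (hd.trans (hML ▸ card_map_dvd M π)) hQb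

/-- In a nontrivial group the Sylow subgroup for the largest prime divisor is normal and nontrivial,
so that prime must be `r`. -/
theorem exists_normal_sylow_of_sylowKPt (h : sylowKPt t G) {r : ℕ} (hr : r.Prime)
    (hno : ∀ p : ℕ, p.Prime → p ≠ r → ∀ T : Subgroup G, T.Normal → IsPGroup p T → T = ⊥) :
    ∃ R : Sylow r G, (R : Subgroup G).Normal := by
  have := Fact.mk hr
  obtain ⟨R⟩ : Nonempty (Sylow r G) := inferInstance
  rcases subsingleton_or_nontrivial G with hs | hs
  · exact ⟨R, ⟨fun x hx g => by rwa [Subsingleton.elim (g * x * g⁻¹) x]⟩⟩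
  obtain ⟨p, hp, hmax⟩ := (Nat.card G).primeFactors.exists_max_image id
    (Nat.nonempty_primeFactors.2 Finite.one_lt_card)
  have hpp := Nat.prime_of_mem_primeFactors hp
  have := Fact.mk hpp
  have hnorm : ∀ S : Sylow p G, (S : Subgroup G).Normal := fun S =>
    sylow_normal_of_isKPtSubnormal hpp
      (fun r hr hd => hmax r (Nat.mem_primeFactors.2 ⟨hr, hd, Nat.card_pos.ne'⟩)) S (h p hpp S)
  by_cases hpr : p = r
  · subst hpr
    exact ⟨R, hnorm R⟩
  · obtain ⟨S⟩ : Nonempty (Sylow p G) := inferInstance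
    exact absurd (hno p hpp hpr S (hnorm S) S.isPGroup')
      (S.ne_bot_of_dvd_card (Nat.dvd_of_mem_primeFactors hp))

theorem sylowKPt_of_quotient_bot {M : Subgroup G} [M.Normal] (hM : M = ⊥)
    (h : sylowKPt t (G ⧸ M)) : sylowKPt t G :=
  sylowKPt_of_surjective (f := QuotientGroup.lift M (MonoidHom.id G) fun x hx => by
    rw [hM, mem_bot] at hx
    exact hx) (fun g => ⟨g, rfl⟩) h

theorem sylowKPt_quotient_quotient_frattini (N : Subgroup G) [N.Normal]
    (h : sylowKPt t (G ⧸ frattini G)) : sylowKPt t ((G ⧸ N) ⧸ frattini (G ⧸ N)) := by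
  refine sylowKPt_of_surjective (f := QuotientGroup.map (frattini G) (frattini (G ⧸ N))
    (QuotientGroup.mk' N)
    (frattini_le_comap_frattini_of_surjective (QuotientGroup.mk'_surjective N))) ?_ h
  intro x
  obtain ⟨y, rfl⟩ := QuotientGroup.mk_surjective x
  obtain ⟨g, rfl⟩ := QuotientGroup.mk_surjective y
  exact ⟨g, rfl⟩

/-- Passage from `G/N` to `G` for a minimal normal subgroup `N` over which no prime other than
`r` gives rise to a normal subgroup. -/
theorem sylowKPt_of_quotient_isMinimalNormal [Group.IsSolvable G] {N : Subgroup G} [N.Normal]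
    (hN : IsMinimalNormal N) {r : ℕ} (hr : r.Prime) (hd : r ∣ Nat.card N)
    (h : sylowKPt t (G ⧸ N))
    (hno : ∀ p : ℕ, p.Prime → p ≠ r → ∀ T : Subgroup (G ⧸ N), T.Normal → IsPGroup p T → T = ⊥) :
    sylowKPt t G := by
  intro q hq P
  have := Fact.mk hq
  have := Fact.mk hr
  have hNr := hN.isPGroup hN.comm hr hd
  refine Relation.ReflTransGen.trans ?_ (isKPtSubnormal_sup_of_quotient h hq P)
  by_cases hqr : q = r
  · subst hqr
    rw [sylow_sup_eq_of_isPGroup hNr P]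
  let π := QuotientGroup.mk' N
  have hπ : Function.Surjective π := QuotientGroup.mk'_surjective N
  have hsol : Group.IsSolvable (G ⧸ N) := Group.isSolvable_of_surjective hπ
  obtain ⟨R, hR⟩ := exists_normal_sylow_of_sylowKPt h hr hno
  have hRC := centralizer_le_of_normal_sylow hr hno R
  have hPp : IsPGroup q ((P : Subgroup G).map π) := P.isPGroup'.map π
  have hcop : (Nat.card ((P : Subgroup G).map π)).Coprime (Nat.card (R : Subgroup (G ⧸ N))) :=
    IsPGroup.coprime_card_of_ne q r hqr _ _ hPp R.isPGroup'
  have hch : KPtChain t ((P : Subgroup G).map π) ((P : Subgroup G).map π ⊔ R) := by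
    have h1 := KPtChain.inf (h q hq (P.mapSurjective hπ)) ((P : Subgroup G).map π ⊔ R)
    rwa [Sylow.coe_mapSurjective, inf_eq_left.2 le_sup_left, top_inf_eq] at h1
  -- `P` acts faithfully on `R`: what centralizes `R` has its image in `R`, which meets the image of
  -- `P` trivially, and `P ∩ N = 1`. Relations satisfied by the action on `R` therefore hold in `P`
  -- itself, and so for its action on `N`.
  have hone : ∀ x ∈ P, (∀ u ∈ R, Commute (π x) u) → x = 1 := by
    intro x hx hxu
    have h1 : π x ∈ (P : Subgroup G).map π ⊓ R :=
      ⟨mem_map_of_mem π hx, hRC (mem_centralizer_iff.2 fun u hu => (hxu u hu).symm)⟩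
    rw [(disjoint_of_coprime_natCard hcop).eq_bot, mem_bot] at h1
    have h2 : x ∈ (P : Subgroup G) ⊓ N := ⟨hx, (QuotientGroup.eq_one_iff x).1 h1⟩
    rwa [(IsPGroup.disjoint_of_ne q r hqr _ _ P.isPGroup' hNr).eq_bot, mem_bot] at h2
  by_cases hf : PowerFree t (r - 1)
  · refine kptChain_sup_of_diagonalizable hN.comm hr (hN.pow_eq_one hN.comm hr hd) hf ?_
    intro x hx y hy u _
    have hxy : ∀ v ∈ R, _ := fun v hv => hch.commute_of_powerFree hr R.isPGroup' hcop
      (mem_map_of_mem π hx) (mem_map_of_mem π hy) hv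
    have h1 : ⁅x, y⁆ = 1 := hone _ (mul_mem (mul_mem (mul_mem hx hy) (inv_mem hx)) (inv_mem hy))
      fun v hv => by
        rw [map_commutatorElement]
        exact (hxy v hv).1
    have h2 : x ^ (r - 1) = 1 := hone _ (pow_mem hx _) fun v hv => by
      rw [map_pow]
      exact (hxy v hv).2
    rw [h1, h2]
    exact ⟨Commute.one_left u, Commute.one_left u⟩
  · refine kptChain_sup_of_commute fun x hx u _ => ?_
    rw [hone x hx fun v hv => hch.commute_of_not_powerFree hr R.isPGroup' hcop hf
      (mem_map_of_mem π hx) hv]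
    exact Commute.one_left u

theorem sylowKPt_of_quotient_frattini (h : sylowKPt t (G ⧸ frattini G)) : sylowKPt t G := by
  induction hn : Nat.card G using Nat.strong_induction_on generalizing G with
  | _ n ih =>
    have hquot : ∀ M : Subgroup G, [M.Normal] → M ≠ ⊥ → sylowKPt t (G ⧸ M) := by
      intro M _ hM
      refine ih _ ?_ (sylowKPt_quotient_quotient_frattini M h) rfl
      rw [← hn, ← card_mul_index M, ← index_eq_card]
      exact lt_mul_of_one_lt_left (Nat.pos_of_ne_zero index_ne_zero_of_finite)
        ((one_lt_card_iff_ne_bot M).2 hM)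
    by_cases hb : frattini G = ⊥
    · exact sylowKPt_of_quotient_bot hb h
    obtain ⟨N, hN, hNF⟩ := exists_isMinimalNormal_le (frattini G) hb
    have := hN.normal
    -- If a nontrivial normal `T` meets `N` trivially, `G` is a subdirect product of `G/N` and
    -- `G/T`, both in the class by induction.
    by_cases hex : ∃ T : Subgroup G, T.Normal ∧ T ≠ ⊥ ∧ N ⊓ T = ⊥
    · obtain ⟨T, hT, hTb, hNT⟩ := hex
      exact sylowKPt_of_quotient_bot hNT
        (sylowKPt_quotient_inf N T (hquot N hN.ne_bot) (hquot T hTb))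
    have hsol : Group.IsSolvable G := by
      have h1 : Group.IsNilpotent (frattini G) := frattini_nilpotent
      exact (Group.isSolvable_iff_subgroup_quotient (frattini G)).2
        ⟨inferInstance, isSolvable_of_sylowKPt h⟩
    obtain ⟨r, hr, hd⟩ := Nat.exists_prime_and_dvd (fun h1 => hN.ne_bot (card_eq_one.1 h1))
    refine sylowKPt_of_quotient_isMinimalNormal hN hr hd (hquot N hN.ne_bot) ?_
    intro p hp hpr T hT hTp
    by_contra hTb
    obtain ⟨S, hS, hSp, hSb⟩ := exists_normal_isPGroup_of_le_frattini hNF hp hTp hTb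
    have := Fact.mk hp
    have := Fact.mk hr
    exact hex ⟨S, hS, hSb, (IsPGroup.disjoint_of_ne r p hpr.symm N S
      (hN.isPGroup hN.comm hr hd) hSp).eq_bot⟩

end Saturation

end GroupFormation

theorem theorem3p2 (t : ℕ) :
    GroupFormation.IsFormation (GroupFormation.sylowKPt.{u} t) ∧
    GroupFormation.IsHereditary (GroupFormation.sylowKPt.{u} t) ∧
    GroupFormation.IsSaturated (GroupFormation.sylowKPt.{u} t) ∧
    GroupFormation.IsLocallyDefinedBy (GroupFormation.sylowKPt.{u} t)
      (GroupFormation.localF.{u} t) := by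
  refine ⟨GroupFormation.sylowKPt_isFormation t, GroupFormation.sylowKPt_isHereditary t,
    fun G _ _ h => GroupFormation.sylowKPt_of_quotient_frattini h,
    GroupFormation.localF_isLocalFunction t, ?_⟩
  funext G _ _
  exact propext ⟨fun h => GroupFormation.LF_localF_of_sylowKPt h,
    fun h => GroupFormation.sylowKPt_of_LF_localF h⟩
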